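/- Let $\triangle$ be the infinite triangular grid: its vertices are the classes $\varphi(x,y,z)$ of $(x,y,z)\in\mathbb Z^3$ modulo $(1,1,1)$, and its edges, taken in their positive orientation, are $v\to v+\varphi(e_i)$ for a vertex $v$ and a unit vector $e_i$, $i=1,2,3$. A lozenge is the union of two triangles of $\triangle$ with a common edge, and we say that it overlaps this edge; its orientation is the direction of the overlapped edge. For finite sets $X_1,X_2$ of edges of $\triangle$, the problem $\mathrm{Tiling}(\triangle,X_1,X_2)$ asks for a set of lozenges such that every triangle of $\triangle$ is contained in exactly one of them, no edge of $X_1\cup X_2$ is overlapped, and for every edge of $X_2$ the two lozenges adjacent to it have different orientations. Let $DC(\triangle,X_1,X_2)$ be the weighted directed graph on the vertices of $\triangle$ with the following edges: every positively oriented edge of $\triangle$, with weight $+1$; the negative orientation of every edge of $X_1\cup X_2$, with weight $-1$; and, for every edge $uv$ of $X_2$, the two edges $w\to w'$ and $w'\to w$ of weight $0$, where $w,w'$ are the two common neighbours of $u$ and $v$. The system of difference constraints of a weighted directed graph asks for an integer function $h$ on the vertices with $h(v)-h(u)\le c$ for every edge $u\to v$ of weight $c$; the graph is called feasible if it has a solution.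 Let $G^+$ (respectively $G^-$) consist of the edges of $DC(\triangle,X_1,X_2)$ of positive (respectively non-positive) weight and their incident vertices, and let $G^{+-}$ be obtained from $G^-$ by adding, for all vertices $u\neq v$ of $G^-$, an edge $u\to v$ whose weight is the distance from $u$ to $v$ in $G^+$. Then the following hold. 1. For all finite $X_1,X_2$, the graph $G^{+-}$ is finite, and $$\mathrm{Tiling}(\triangle,X_1,X_2)\text{ has a solution}\iff DC(\triangle,X_1,X_2)\text{ is feasible}\iff G^{+-}\text{ is feasible}.$$ The distance in $G^+$ from $\varphi(x,y,z)$ to $\varphi(x',y',z')$ is $$(x'-x)+(y'-y)+(z'-z)-3\min\{x'-x,\;y'-y,\;z'-z\}.$$ Moreover $G^{+-}$ is feasible if and only if the Bellman–Ford algorithm accepts it, that is, if and only if the values obtained from the all-zero function on the vertices by as many rounds of relaxation of all edges as $G^{+-}$ has vertices satisfy all the difference constraints of $G^{+-}$. 2. There are a constant $C$ and a single program for a random access machine with integer cells (unit-cost addition, subtraction, comparison with $0$ and indirect memory access) that, given lists without repetition of the edges of any finite sets $X_1$ and $X_2$, halts after at most $C\,(|X_1\cup X_2|^3+1)$ steps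 and decides whether $\mathrm{Tiling}(\triangle,X_1,X_2)$ has a solution. If it has one, the program also outputs the Bellman–Ford values at all vertices of $G^{+-}$, a solution of the finite system of difference constraints. In particular, feasibility is decided in time $O(|X_1\cup X_2|^3)$. -/

import Mathlib

namespace LozengeGrid

/-! ### The triangular grid, lozenges and tilings -/

/-- Vertices of the infinite triangular grid: the classes of `ℤ³` modulo `(1,1,1)`, where the class of
`(x, y, z)` is recorded by the pair `(x - z, y - z)`. -/
abbrev Vertex : Type := ℤ × ℤ

/-- The projection of the cubic lattice along `(1,1,1)`. -/
def proj (x y z : ℤ) : Vertex := (x - z, y - z)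

/-- The three positive directions of the grid: the projections of the three unit vectors. -/
def dir : Fin 3 → Vertex := ![proj 1 0 0, proj 0 1 0, proj 0 0 1]

/-- Edges of the grid. Every undirected edge has exactly one positive orientation; `(v, i)` is the
edge whose positive orientation is `v → v + dir i`. -/
abbrev Edge : Type := Vertex × Fin 3

/-- The starting point of the positive orientation of an edge. -/
def Edge.src (e : Edge) : Vertex := e.1

/-- The end point of the positive orientation of an edge. -/
def Edge.tgt (e : Edge) : Vertex := e.1 + dir e.2

/-- The two end points of an edge. -/
def Edge.ends (e : Edge) : Finset Vertex := {Edge.src e, Edge.tgt e}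

/-- Two vertices are adjacent when they are the two end points of an edge. -/
def Adj (u v : Vertex) : Prop := ∃ i : Fin 3, v = u + dir i ∨ u = v + dir i

/-- The triangles of the grid: triples of mutually adjacent vertices. -/
def triangles : Set (Finset Vertex) :=
  {t | t.card = 3 ∧ ∀ u ∈ t, ∀ v ∈ t, u ≠ v → Adj u v}

/-- A lozenge is the projection of a unit square of the cubic lattice with lowest corner projecting to
`base` and with normal direction `normal`. The normal direction is the orientation of the lozenge. -/
@[ext]
structure Lozenge where
  base : Vertex
  normal : Fin 3

/-- The four corners of a lozenge. -/
def Lozenge.verts (L : Lozenge) : Finset Vertex :=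
  {L.base, L.base + dir (L.normal + 1), L.base + dir (L.normal + 2),
    L.base + dir (L.normal + 1) + dir (L.normal + 2)}

/-- A lozenge overlaps the grid edge that joins the projections of the lowest and highest corner of
its square (its short diagonal). The other grid edges between its corners are its four sides. -/
def Lozenge.Overlaps (L : Lozenge) (e : Edge) : Prop :=
  Edge.ends e = {L.base, L.base + dir (L.normal + 1) + dir (L.normal + 2)}

/-- A set of lozenges tiles the whole grid when every triangle lies in exactly one of them. -/
def IsTiling (T : Set Lozenge) : Prop :=
  ∀ t ∈ triangles, ∃! L : Lozenge, L ∈ T ∧ t ⊆ L.verts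

/-- The solutions of the tiling problem on the whole grid: no edge of `X₁ ∪ X₂` is overlapped, and the two
lozenges of `T` adjacent to an edge of `X₂` have different orientations. -/
structure IsSolution (X₁ X₂ : Finset Edge) (T : Set Lozenge) : Prop where
  tiling : IsTiling T
  nonoverlap : ∀ e ∈ X₁ ∪ X₂, ∀ L ∈ T, ¬ L.Overlaps e
  salient : ∀ e ∈ X₂, ∀ L ∈ T, ∀ L' ∈ T, L ≠ L' →
    Edge.ends e ⊆ L.verts → Edge.ends e ⊆ L'.verts → L.normal ≠ L'.normal

/-- The whole grid has a tiling that respects the constraints. -/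
def Tilable (X₁ X₂ : Finset Edge) : Prop := ∃ T : Set Lozenge, IsSolution X₁ X₂ T

/-! ### Weighted directed graphs and systems of difference constraints -/

/-- A directed graph with integer weights; `(u, v, w) ∈ edges` is an edge `u → v` of weight `w`. -/
structure WDigraph (V : Type) where
  verts : Set V
  edges : Set (V × V × ℤ)

namespace WDigraph

variable {V : Type}

/-- `h` solves the system of difference constraints induced by the graph. -/
def Solves (G : WDigraph V) (h : V → ℤ) : Prop :=
  ∀ u v w, (u, v, w) ∈ G.edges → h v - h u ≤ w

/-- The system of difference constraints induced by the graph has an integer solution. -/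
def Feasible (G : WDigraph V) : Prop := ∃ h : V → ℤ, G.Solves h

/-- The edges whose weight satisfies `p`, with their incident vertices. -/
def filterWeight (G : WDigraph V) (p : ℤ → Prop) : WDigraph V where
  verts := {x | ∃ u v w, (u, v, w) ∈ G.edges ∧ p w ∧ (x = u ∨ x = v)}
  edges := {a | a ∈ G.edges ∧ p a.2.2}

/-- `G.Walk u v c`: there is a directed walk from `u` to `v` of total weight `c`. -/
inductive Walk (G : WDigraph V) : V → V → ℤ → Prop
  | nil {v : V} : v ∈ G.verts → Walk G v v 0
  | cons {u v x : V} {w c : ℤ} : (u, v, w) ∈ G.edges → Walk G v x c → Walk G u x (w + c)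

/-- `d` is the distance from `u` to `v`, the least weight of a walk. -/
def IsDist (G : WDigraph V) (u v : V) (d : ℤ) : Prop := IsLeast {c | G.Walk u v c} d

/-- One round of Bellman–Ford: every edge is relaxed once. (On a finite graph the infimum is that of
a finite nonempty set, hence a minimum.) -/
noncomputable def relax (G : WDigraph V) (f : V → ℤ) (v : V) : ℤ :=
  sInf (insert (f v) {x | ∃ u w, (u, v, w) ∈ G.edges ∧ x = f u + w})

/-- The values computed by Bellman–Ford for a finite system of difference constraints: all values
start at `0` (an additional source is joined to every vertex by an edge of weight `0`), and then as many
rounds of relaxation are made as there are vertices. -/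
noncomputable def bellmanFord (G : WDigraph V) : V → ℤ :=
  (G.relax)^[G.verts.ncard] (fun _ => 0)

/-- The final test of Bellman–Ford: no edge can be relaxed any more. -/
def BellmanFordAccepts (G : WDigraph V) : Prop := G.Solves G.bellmanFord

end WDigraph

/-- The graph `DC(△, X₁, X₂)` of the whole grid (which has no boundary). The edges are, in this order, the
positive edges, the negative orientations of constrained edges, and the pairs of lateral edges between the
two common neighbours of the end points of an edge of `X₂`. -/
def DC (X₁ X₂ : Finset Edge) : WDigraph Vertex where
  verts := Set.univ
  edges := {a | ∃ e : Edge, a = (e.src, e.tgt, 1)} ∪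
    {a | ∃ e ∈ X₁ ∪ X₂, a = (Edge.tgt e, Edge.src e, -1)} ∪
    {a | ∃ e ∈ X₂, ∃ w w' : Vertex, w ≠ w' ∧
      Adj w (Edge.src e) ∧ Adj w (Edge.tgt e) ∧ Adj w' (Edge.src e) ∧ Adj w' (Edge.tgt e) ∧
      a = (w, w', 0)}

/-- The positive graph `G⁺`. -/
def posGraph (X₁ X₂ : Finset Edge) : WDigraph Vertex := (DC X₁ X₂).filterWeight (fun w => 0 < w)

/-- The negative graph `G⁻`. -/
def negGraph (X₁ X₂ : Finset Edge) : WDigraph Vertex := (DC X₁ X₂).filterWeight (fun w => w ≤ 0)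

/-- The graph `G⁺⁻`: the negative graph, together with an edge from every vertex to every other one
weighted by the distance in the positive graph. -/
def posNegGraph (X₁ X₂ : Finset Edge) : WDigraph Vertex where
  verts := (negGraph X₁ X₂).verts
  edges := (negGraph X₁ X₂).edges ∪
    {a | a.1 ∈ (negGraph X₁ X₂).verts ∧ a.2.1 ∈ (negGraph X₁ X₂).verts ∧ a.1 ≠ a.2.1 ∧
      (posGraph X₁ X₂).IsDist a.1 a.2.1 a.2.2}

/-! ### A random access machine with integer cells and unit cost -/

/-- A state of the machine: integer registers and an integer memory with indirect access. -/
@[ext]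
structure State where
  reg : ℕ → ℤ
  mem : ℤ → ℤ

/-- Programs of the machine. -/
inductive Prog : Type
  | skip : Prog
  | const (r : ℕ) (c : ℤ) : Prog
  | add (r a b : ℕ) : Prog
  | sub (r a b : ℕ) : Prog
  | load (r a : ℕ) : Prog
  | store (a b : ℕ) : Prog
  | seq (p q : Prog) : Prog
  | ifPos (r : ℕ) (p q : Prog) : Prog
  | whilePos (r : ℕ) (p : Prog) : Prog

/-- Assign a value to a register. -/
def State.setReg (s : State) (r : ℕ) (x : ℤ) : State := ⟨Function.update s.reg r x, s.mem⟩

/-- Assign a value to a memory cell. -/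
def State.setMem (s : State) (a x : ℤ) : State := ⟨s.reg, Function.update s.mem a x⟩

/-- `Exec p s t s'`: started in `s`, the program `p` halts in `s'` after exactly `t` steps. Each elementary
instruction and each evaluation of a test is one step. -/
inductive Exec : Prog → State → ℕ → State → Prop
  | skip (s : State) : Exec .skip s 1 s
  | const (s : State) (r : ℕ) (c : ℤ) : Exec (.const r c) s 1 (s.setReg r c)
  | add (s : State) (r a b : ℕ) : Exec (.add r a b) s 1 (s.setReg r (s.reg a + s.reg b))
  | sub (s : State) (r a b : ℕ) : Exec (.sub r a b) s 1 (s.setReg r (s.reg a - s.reg b))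
  | load (s : State) (r a : ℕ) : Exec (.load r a) s 1 (s.setReg r (s.mem (s.reg a)))
  | store (s : State) (a b : ℕ) : Exec (.store a b) s 1 (s.setMem (s.reg a) (s.reg b))
  | seq {p q : Prog} {s s' s'' : State} {t t' : ℕ} :
      Exec p s t s' → Exec q s' t' s'' → Exec (.seq p q) s (t + t') s''
  | ifTrue {r : ℕ} {p q : Prog} {s s' : State} {t : ℕ} :
      0 < s.reg r → Exec p s t s' → Exec (.ifPos r p q) s (t + 1) s'
  | ifFalse {r : ℕ} {p q : Prog} {s s' : State} {t : ℕ} :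
      ¬ 0 < s.reg r → Exec q s t s' → Exec (.ifPos r p q) s (t + 1) s'
  | whileTrue {r : ℕ} {p : Prog} {s s' s'' : State} {t t' : ℕ} :
      0 < s.reg r → Exec p s t s' → Exec (.whilePos r p) s' t' s'' →
      Exec (.whilePos r p) s (t + t' + 1) s''
  | whileFalse {r : ℕ} {p : Prog} {s : State} :
      ¬ 0 < s.reg r → Exec (.whilePos r p) s 1 s

/-- The machine is deterministic: final state and running time are determined by the initial state. -/
theorem Exec.deterministic {p : Prog} {s s₁ s₂ : State} {t₁ t₂ : ℕ}
    (h₁ : Exec p s t₁ s₁) (h₂ : Exec p s t₂ s₂) : t₁ = t₂ ∧ s₁ = s₂ := by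
  induction h₁ generalizing t₂ s₂ with
  | skip | const | add | sub | load | store => cases h₂; exact ⟨rfl, rfl⟩
  | seq _ _ ih ih' =>
    cases h₂ with
    | seq a b =>
      obtain ⟨rfl, rfl⟩ := ih a
      obtain ⟨rfl, rfl⟩ := ih' b
      exact ⟨rfl, rfl⟩
  | ifTrue h _ ih =>
    cases h₂ with
    | ifTrue _ a => obtain ⟨rfl, rfl⟩ := ih a; exact ⟨rfl, rfl⟩
    | ifFalse h' _ => exact absurd h h'
  | ifFalse h _ ih =>
    cases h₂ with
    | ifTrue h' _ => exact absurd h' h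
    | ifFalse _ a => obtain ⟨rfl, rfl⟩ := ih a; exact ⟨rfl, rfl⟩
  | whileTrue h _ _ ih ih' =>
    cases h₂ with
    | whileTrue _ a b =>
      obtain ⟨rfl, rfl⟩ := ih a
      obtain ⟨rfl, rfl⟩ := ih' b
      exact ⟨rfl, rfl⟩
    | whileFalse h' => exact absurd h h'
  | whileFalse h =>
    cases h₂ with
    | whileTrue h' _ _ => exact absurd h' h
    | whileFalse _ => exact ⟨rfl, rfl⟩

/-- A list of edges as a list of integers, three for each edge: the two coordinates of the starting
point of its positive orientation, and the index `0`, `1` or `2` of its direction. -/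
def encode (l : List Edge) : List ℤ :=
  l.flatMap (fun e => [e.1.1, e.1.2, ((e.2 : ℕ) : ℤ)])

/-- The initial state for the input `l₁`, `l₂`: the registers `0` and `1` hold the lengths of the two lists, the
memory holds the edges of `l₁` followed by those of `l₂`, from address `0` on, and all else is `0`. -/
def inputState (l₁ l₂ : List Edge) : State where
  reg := fun r => if r = 0 then (l₁.length : ℤ) else if r = 1 then (l₂.length : ℤ) else 0
  mem := fun a => if 0 ≤ a then (encode (l₁ ++ l₂)).getD a.toNat 0 else 0

/-- The table of vertices and values stored in a state: register `1` holds its address, register `2` the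
number of its entries, and an entry takes three cells, two coordinates and a value. -/
def State.table (s : State) : Set (Vertex × ℤ) :=
  {x | ∃ k : ℕ, (k : ℤ) < s.reg 2 ∧
    x = ((s.mem (s.reg 1 + 3 * k), s.mem (s.reg 1 + 3 * k + 1)), s.mem (s.reg 1 + 3 * k + 2))}

end LozengeGrid

open LozengeGrid

/-! Tilings correspond to height functions. Give an edge the jump `-2` if the tiling overlaps it and
`1` otherwise. A triangle lies in exactly one lozenge precisely when the jumps of its three edges
add up to zero (`isTiling_iff`). On the simply connected grid such jumps are the differences of a
function `h` (`Irrotational.exists_isPotential`). An edge is not overlapped exactly when `h` does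
not drop by `2` along it, and two lozenges at a non-overlapped edge have different orientations
exactly when `h` agrees at its two common neighbours (`salient_iff`). Hence a tiling yields a
solution of the difference constraints. Conversely, an arbitrary solution need not have jumps `1`
and `-2`. Rounding each value down to the residue class of `x + y` modulo `3` preserves all
constraints, because every weight is congruent to the difference of the classes of its end points,
and after rounding only these two jumps are possible (`tilable_of_feasible`).

For the reduction to a finite graph, the positive edges say that `h v - h u` is at most the distance
in the positive graph. A solution on the vertices of the negative graph that respects these
distances extends to the whole grid by `v ↦ min_u (g u + dist u v)`
(`feasible_iff_posNegGraph_feasible`).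

Bellman–Ford is analysed through the greatest nonpositive solution. Rounds starting from zero never
fall below it, and each round makes at least one more vertex reach it until all have
(`Rounds.card_le`). The argument is independent of the order of relaxation, so it covers both the
simultaneous rounds of `relax` and the in-place rounds of the machine.

The machine stores four entries for each of the `n` input edges (end points and common neighbours),
with repetitions. Copies of a vertex are at distance zero from each other, so the constraints force
equal values on them and the graph on entries has the same greatest solution as the original one
(`bellmanFord_point`). It makes `4 * n + 1` rounds of quadratic cost, and feasibility is equivalent
to the last one changing nothing (`wp_relaxRounds`). -/

namespace LozengeGrid

/-! ### Rounds of relaxation -/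

namespace WDigraph

variable {V : Type} {G : WDigraph V}

/-- Both end points of every edge are vertices. -/
def Closed (G : WDigraph V) : Prop := ∀ u v w, (u, v, w) ∈ G.edges → u ∈ G.verts ∧ v ∈ G.verts

/-- `f'` arises from `f` by relaxing every edge at least once, in any order. -/
structure Round (G : WDigraph V) (f f' : V → ℤ) : Prop where
  le : ∀ v ∈ G.verts, f' v ≤ f v
  relaxed : ∀ u v w, (u, v, w) ∈ G.edges → f' v ≤ f u + w
  lower : ∀ h, G.Solves h → (∀ v ∈ G.verts, h v ≤ f v) → ∀ v ∈ G.verts, h v ≤ f' v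

/-- `f` arises from the zero function by `k` rounds of relaxation. -/
inductive Rounds (G : WDigraph V) : ℕ → (V → ℤ) → Prop
  | zero {f : V → ℤ} : (∀ v ∈ G.verts, f v = 0) → Rounds G 0 f
  | succ {k : ℕ} {f f' : V → ℤ} : Rounds G k f → G.Round f f' → Rounds G (k + 1) f'

/-- A greatest nonpositive solution. -/
structure IsMaxSol (G : WDigraph V) (g : V → ℤ) : Prop where
  solves : G.Solves g
  nonpos : ∀ v ∈ G.verts, g v ≤ 0
  max : ∀ h, G.Solves h → (∀ v ∈ G.verts, h v ≤ 0) → ∀ v ∈ G.verts, h v ≤ g v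

theorem Rounds.nonpos {k : ℕ} {f : V → ℤ} (hf : G.Rounds k f) : ∀ v ∈ G.verts, f v ≤ 0 := by
  induction hf with
  | zero h => exact fun v hv => (h v hv).le
  | succ _ h ih => exact fun v hv => (h.le v hv).trans (ih v hv)

theorem Rounds.lower {k : ℕ} {f h : V → ℤ} (hf : G.Rounds k f) (hs : G.Solves h)
    (h0 : ∀ v ∈ G.verts, h v ≤ 0) : ∀ v ∈ G.verts, h v ≤ f v := by
  induction hf with
  | zero hz => exact fun v hv => (h0 v hv).trans (hz v hv).ge
  | succ _ hr ih => exact hr.lower h hs ih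

/-- Difference constraints are preserved under pointwise suprema. The family of nonpositive
solutions is nonempty, since a solution can be shifted down by an upper bound of its values on the
finite vertex set. -/
theorem exists_isMaxSol (hfin : G.verts.Finite) (hc : G.Closed) (hG : G.Feasible) :
    ∃ g, G.IsMaxSol g := by
  obtain ⟨h₀, hs₀⟩ := hG
  obtain ⟨B, hB⟩ := (hfin.image h₀).bddAbove
  let A : V → Set ℤ := fun v => {x | ∃ h, G.Solves h ∧ (∀ v ∈ G.verts, h v ≤ 0) ∧ x = h v}
  have hne : ∀ v, (A v).Nonempty := fun v =>
    ⟨_, fun v => h₀ v - B, fun a b w hw => by have := hs₀ a b w hw; lia,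
      fun v hv => by have := hB ⟨v, hv, rfl⟩; lia, rfl⟩
  have hbd : ∀ v ∈ G.verts, BddAbove (A v) := fun v hv =>
    ⟨0, by rintro _ ⟨h, -, h0, rfl⟩; exact h0 v hv⟩
  refine ⟨fun v => sSup (A v), ?_, ?_, ?_⟩
  · intro u v w hw
    have : sSup (A v) ≤ sSup (A u) + w := by
      refine csSup_le (hne v) ?_
      rintro _ ⟨h, hs, h0, rfl⟩
      have h1 := hs u v w hw
      have h2 : h u ≤ sSup (A u) := le_csSup (hbd u (hc u v w hw).1) ⟨h, hs, h0, rfl⟩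
      lia
    simp only; lia
  · intro v hv
    refine csSup_le (hne v) ?_
    rintro _ ⟨h, -, h0, rfl⟩
    exact h0 v hv
  · intro h hs h0 v hv
    exact le_csSup (hbd v hv) ⟨h, hs, h0, rfl⟩

/-- A set of vertices that no tight edge of a greatest nonpositive solution leaves, and which contains
all zeros of that solution, contains all vertices. -/
theorem IsMaxSol.subset_of_closed {g : V → ℤ} (hg : G.IsMaxSol g) (S : Set V)
    (h0 : ∀ v ∈ G.verts, g v = 0 → v ∈ S)
    (hS : ∀ u v w, (u, v, w) ∈ G.edges → u ∈ S → g v = g u + w → v ∈ S) : G.verts ⊆ S := by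
  classical
  by_contra hne
  obtain ⟨x, hx, hxS⟩ := Set.not_subset.mp hne
  -- Raising `g` by one outside `S` violates no constraint, since edges leaving `S` are not tight,
  -- and keeps it nonpositive, since zeros lie in `S`. This contradicts maximality at `x`.
  have key := hg.max (fun v => if v ∈ S then g v else g v + 1) ?_ ?_ x hx
  · simp [hxS] at key
  · intro u v w hw
    have h1 := hg.solves u v w hw
    have h2 := hS u v w hw
    by_cases hu : u ∈ S <;> by_cases hv : v ∈ S <;> simp only [hu, hv, if_true, if_false] <;> lia
  · intro v hv
    have h1 := hg.nonpos v hv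
    have h2 := h0 v hv
    by_cases hvS : v ∈ S <;> simp only [hvS, if_true, if_false]
    · exact h1
    · have := mt h2 hvS
      lia

/-- Once a vertex has its final value it keeps it, being squeezed between decreasing iterates and
the lower bound `g`. A round that settles no new vertex shows that the settled set is closed under
tight edges, hence is everything. -/
theorem Rounds.card_le {g f : V → ℤ} {k : ℕ} (hg : G.IsMaxSol g) (hc : G.Closed)
    (hfin : G.verts.Finite) (hf : G.Rounds k f) :
    min (k + 1) G.verts.ncard ≤ {v ∈ G.verts | f v = g v}.ncard := by
  induction hf with
  | @zero f hz =>
    rcases G.verts.eq_empty_or_nonempty with he | ⟨x, hx⟩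
    · simp [he]
    · have hne : {v ∈ G.verts | f v = g v}.Nonempty := by
        -- If no vertex had `g v = 0`, the empty set would satisfy the closure criterion.
        by_contra hne
        rw [Set.not_nonempty_iff_eq_empty] at hne
        have := hg.subset_of_closed ∅ (fun v hv h => by
          have : v ∈ {v ∈ G.verts | f v = g v} := ⟨hv, by rw [hz v hv, h]⟩
          rwa [hne] at this) (by simp)
        exact this hx
      have := (Set.ncard_pos (hfin.subset (Set.sep_subset _ _))).2 hne
      lia
  | @succ k f f' hf hr ih =>
    have hlow' := (hf.succ hr).lower hg.solves hg.nonpos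
    have hsub : {v ∈ G.verts | f v = g v} ⊆ {v ∈ G.verts | f' v = g v} := by
      rintro v ⟨hv, h⟩
      exact ⟨hv, le_antisymm (h ▸ hr.le v hv) (hlow' v hv)⟩
    have hfin' : {v ∈ G.verts | f' v = g v}.Finite := hfin.subset (Set.sep_subset _ _)
    by_cases heq : {v ∈ G.verts | f v = g v} = {v ∈ G.verts | f' v = g v}
    · have hall := hg.subset_of_closed {v ∈ G.verts | f v = g v}
        (fun v hv h => ⟨hv, le_antisymm (h ▸ hf.nonpos v hv) (hf.lower hg.solves hg.nonpos v hv)⟩)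
        -- Relaxing a tight edge out of a settled vertex settles its head in the next round, and by
        -- assumption that head was already settled.
        (fun u v w hw hu h => by
          rw [heq]
          have hv := (hc u v w hw).2
          refine ⟨hv, le_antisymm ?_ (hlow' v hv)⟩
          have := hr.relaxed u v w hw
          rw [h, ← hu.2]; exact this)
      have : G.verts.ncard ≤ _ := Set.ncard_le_ncard (hall.trans hsub) hfin'
      lia
    · have := Set.ncard_lt_ncard (hsub.ssubset_of_ne heq) hfin'
      lia

theorem Rounds.isMaxSol {f : V → ℤ} {k : ℕ} (hG : G.Feasible) (hc : G.Closed)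
    (hfin : G.verts.Finite) (hk : G.verts.ncard ≤ k) (hf : G.Rounds k f) : G.IsMaxSol f := by
  obtain ⟨g, hg⟩ := exists_isMaxSol hfin hc hG
  have h1 := hf.card_le hg hc hfin
  have h2 : {v ∈ G.verts | f v = g v} = G.verts :=
    Set.eq_of_subset_of_ncard_le (Set.sep_subset _ _) (by lia) hfin
  have h3 : ∀ v ∈ G.verts, f v = g v := fun v hv => (h2.ge hv).2
  refine ⟨fun u v w hw => ?_, hf.nonpos, fun h hs h0 => hf.lower hs h0⟩
  rw [h3 _ (hc u v w hw).1, h3 _ (hc u v w hw).2]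
  exact hg.solves u v w hw

/-! ### The Bellman–Ford algorithm -/

theorem relax_set_finite (hE : G.edges.Finite) (f : V → ℤ) (v : V) :
    (insert (f v) {x | ∃ u w, (u, v, w) ∈ G.edges ∧ x = f u + w}).Finite := by
  refine Set.Finite.insert _ ((hE.image fun a => f a.1 + a.2.2).subset ?_)
  rintro _ ⟨u, w, hw, rfl⟩
  exact ⟨_, hw, rfl⟩

/-- Finiteness of the edge set bounds the set under `sInf` from below, without which the integer
infimum would be a default value. -/
theorem round_relax (hc : G.Closed) (hE : G.edges.Finite) (f : V → ℤ) :
    G.Round f (G.relax f) where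
  le v _ := csInf_le (relax_set_finite hE f v).bddBelow (Set.mem_insert _ _)
  relaxed u v w hw := csInf_le (relax_set_finite hE f v).bddBelow
    (Set.mem_insert_of_mem _ ⟨u, w, hw, rfl⟩)
  lower h hs hle v hv := by
    refine le_csInf (Set.insert_nonempty _ _) ?_
    rintro _ (rfl | ⟨u, w, hw, rfl⟩)
    · exact hle v hv
    · have := hs u v w hw
      have := hle u (hc u v w hw).1
      lia

theorem rounds_bellmanFord (hc : G.Closed) (hE : G.edges.Finite) :
    G.Rounds G.verts.ncard G.bellmanFord := by
  have : ∀ k, G.Rounds k ((G.relax)^[k] (fun _ => 0)) := by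
    intro k
    induction k with
    | zero => exact .zero fun _ _ => rfl
    | succ k ih =>
      rw [Function.iterate_succ_apply']
      exact ih.succ (round_relax hc hE _)
  exact this _

theorem isMaxSol_bellmanFord (hc : G.Closed) (hV : G.verts.Finite) (hE : G.edges.Finite)
    (hG : G.Feasible) : G.IsMaxSol G.bellmanFord :=
  (rounds_bellmanFord hc hE).isMaxSol hG hc hV le_rfl

theorem feasible_iff_bellmanFordAccepts (hc : G.Closed) (hV : G.verts.Finite)
    (hE : G.edges.Finite) : G.Feasible ↔ G.BellmanFordAccepts :=
  ⟨fun h => (isMaxSol_bellmanFord hc hV hE h).solves, fun h => ⟨_, h⟩⟩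

end WDigraph

/-! ### Tilings and height functions -/

theorem dir_zero : dir 0 = (1, 0) := by decide
theorem dir_one : dir 1 = (0, 1) := by decide
theorem dir_two : dir 2 = (-1, -1) := by decide

theorem fin_three_one_add_one : (1 : Fin 3) + 1 = 2 := rfl
theorem fin_three_one_add_two : (1 : Fin 3) + 2 = 0 := rfl
theorem fin_three_two_add_one : (2 : Fin 3) + 1 = 0 := rfl
theorem fin_three_two_add_two : (2 : Fin 3) + 2 = 1 := rfl

theorem fin_three_cases (i : Fin 3) : i = 0 ∨ i = 1 ∨ i = 2 := by
  fin_cases i <;> simp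

theorem adj_iff {a b c d : ℤ} : Adj (a, b) (c, d) ↔
    (c = a + 1 ∧ d = b) ∨ (c = a ∧ d = b + 1) ∨ (c = a - 1 ∧ d = b - 1) ∨
    (a = c + 1 ∧ b = d) ∨ (a = c ∧ b = d + 1) ∨ (a = c - 1 ∧ b = d - 1) := by
  simp only [Adj, Fin.exists_fin_succ, dir_zero, Fin.succ_zero_eq_one, Fin.succ_one_eq_two,
    dir_one, dir_two, Prod.mk_add_mk, Prod.mk.injEq, IsEmpty.exists_iff]
  lia

/-- The lozenge that overlaps an edge. -/
def Edge.lozenge (e : Edge) : Lozenge := ⟨e.1 + dir e.2, e.2⟩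

theorem lozenge_surj (L : Lozenge) : ∃ e : Edge, L = Edge.lozenge e :=
  ⟨(L.base - dir L.normal, L.normal), by simp [Edge.lozenge]⟩

theorem lozenge_inj {e e' : Edge} : Edge.lozenge e = Edge.lozenge e' ↔ e = e' := by
  obtain ⟨v, i⟩ := e
  obtain ⟨v', i'⟩ := e'
  simp only [Edge.lozenge, Lozenge.mk.injEq, Prod.mk.injEq]
  constructor
  · rintro ⟨h, rfl⟩; simpa using h
  · rintro ⟨rfl, rfl⟩; simp

/-- The triangle with lowest vertex `v` and an edge of direction `0` at `v`. -/
def upTri (v : Vertex) : Finset Vertex := {v, v + (1, 0), v + (1, 1)}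

/-- The triangle with lowest vertex `v` and an edge of direction `1` at `v`. -/
def downTri (v : Vertex) : Finset Vertex := {v, v + (0, 1), v + (1, 1)}

theorem upTri_mem (v : Vertex) : upTri v ∈ triangles := by
  obtain ⟨a, b⟩ := v
  refine ⟨?_, ?_⟩
  · rw [upTri, Finset.card_eq_three]
    exact ⟨_, _, _, by simp, by simp, by simp, rfl⟩
  · simp only [upTri, Prod.mk_add_mk, Finset.mem_insert, Finset.mem_singleton]
    rintro _ (rfl | rfl | rfl) _ (rfl | rfl | rfl) <;> simp [adj_iff]

theorem downTri_mem (v : Vertex) : downTri v ∈ triangles := by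
  obtain ⟨a, b⟩ := v
  refine ⟨?_, ?_⟩
  · rw [downTri, Finset.card_eq_three]
    exact ⟨_, _, _, by simp, by simp, by simp, rfl⟩
  · simp only [downTri, Prod.mk_add_mk, Finset.mem_insert, Finset.mem_singleton]
    rintro _ (rfl | rfl | rfl) _ (rfl | rfl | rfl) <;> simp [adj_iff]

theorem mem_triangles {t : Finset Vertex} (ht : t ∈ triangles) :
    ∃ v, t = upTri v ∨ t = downTri v := by
  obtain ⟨hc, hadj⟩ := ht
  obtain ⟨⟨a, a'⟩, ⟨b, b'⟩, ⟨c, c'⟩, hab, hac, hbc, rfl⟩ := Finset.card_eq_three.1 hc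
  have h1 := adj_iff.1 (hadj (a, a') (by simp) (b, b') (by simp) hab)
  have h2 := adj_iff.1 (hadj (a, a') (by simp) (c, c') (by simp) hac)
  have h3 := adj_iff.1 (hadj (b, b') (by simp) (c, c') (by simp) hbc)
  clear hadj hc hab hac hbc
  have key : ∀ t : Finset Vertex, ∀ x y : ℤ,
      (∀ p q : ℤ, (p, q) ∈ t ↔ (p = x ∧ q = y) ∨ (p = x + 1 ∧ q = y) ∨ (p = x + 1 ∧ q = y + 1)) →
        ∃ v, t = upTri v ∨ t = downTri v := fun t x y h =>
    ⟨(x, y), Or.inl (by ext ⟨p, q⟩; rw [h]; simp [upTri])⟩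
  have key' : ∀ t : Finset Vertex, ∀ x y : ℤ,
      (∀ p q : ℤ, (p, q) ∈ t ↔ (p = x ∧ q = y) ∨ (p = x ∧ q = y + 1) ∨ (p = x + 1 ∧ q = y + 1)) →
        ∃ v, t = upTri v ∨ t = downTri v := fun t x y h =>
    ⟨(x, y), Or.inr (by ext ⟨p, q⟩; rw [h]; simp [downTri])⟩
  -- Adjacent vertices differ by `±(1,0)`, `±(0,1)` or `±(1,1)`, so they are comparable
  -- coordinatewise. Three mutually adjacent ones form a chain, whose least element is the base of
  -- the triangle.
  have hm : ∃ x y, (x = a ∧ y = a' ∨ x = b ∧ y = b' ∨ x = c ∧ y = c') ∧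
      x ≤ a ∧ x ≤ b ∧ x ≤ c ∧ y ≤ a' ∧ y ≤ b' ∧ y ≤ c' := by
    by_cases ha : a ≤ b ∧ a ≤ c ∧ a' ≤ b' ∧ a' ≤ c'
    · exact ⟨a, a', by lia⟩
    · by_cases hb : b ≤ a ∧ b ≤ c ∧ b' ≤ a' ∧ b' ≤ c'
      · exact ⟨b, b', by lia⟩
      · exact ⟨c, c', by omega⟩
  obtain ⟨x, y, hxy, hle⟩ := hm
  rcases hxy with ⟨rfl, rfl⟩ | ⟨rfl, rfl⟩ | ⟨rfl, rfl⟩ <;>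
  rcases h1 with h1 | h1 | h1 | h1 | h1 | h1 <;>
  rcases h2 with h2 | h2 | h2 | h2 | h2 | h2 <;>
  first
  | omega
  | refine key _ x y fun p q => ?_
    simp only [Finset.mem_insert, Finset.mem_singleton, Prod.mk.injEq]
    clear h3 key key'
    omega
  | refine key' _ x y fun p q => ?_
    simp only [Finset.mem_insert, Finset.mem_singleton, Prod.mk.injEq]
    clear h3 key key'
    omega

theorem overlaps_iff {e e' : Edge} : (Edge.lozenge e).Overlaps e' ↔ e = e' := by
  obtain ⟨⟨a, b⟩, i⟩ := e
  obtain ⟨⟨a', b'⟩, i'⟩ := e'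
  rw [Lozenge.Overlaps, Edge.ends, Edge.src, Edge.tgt, Edge.lozenge, Finset.ext_iff]
  constructor
  · intro h
    have h1 := h (a, b)
    have h2 := h ((a, b) + dir i)
    rcases fin_three_cases i with rfl | rfl | rfl <;>
    rcases fin_three_cases i' with rfl | rfl | rfl <;>
    simp [dir_zero, dir_one, dir_two, fin_three_one_add_one,
      fin_three_one_add_two, fin_three_two_add_one, fin_three_two_add_two] at h1 h2 ⊢ <;>
    omega
  · rintro ⟨rfl, rfl⟩ ⟨x, y⟩
    rcases fin_three_cases i with rfl | rfl | rfl <;>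
    simp [dir_zero, dir_one, dir_two, fin_three_one_add_one,
      fin_three_one_add_two, fin_three_two_add_one, fin_three_two_add_two] <;>
    omega

/-- The lozenges containing a triangle are those overlapping one of its three edges. -/
theorem upTri_subset_iff {v : Vertex} {e : Edge} : upTri v ⊆ (Edge.lozenge e).verts ↔
    e = (v, 0) ∨ e = (v + (1, 0), 1) ∨ e = (v + (1, 1), 2) := by
  obtain ⟨⟨a, b⟩, i⟩ := e
  obtain ⟨c, d⟩ := v
  rcases fin_three_cases i with rfl | rfl | rfl <;>
  simp [upTri, Finset.insert_subset_iff, Edge.lozenge, Lozenge.verts, dir_zero, dir_one, dir_two,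
      fin_three_one_add_one, fin_three_one_add_two, fin_three_two_add_one,
      fin_three_two_add_two] <;>
  omega

theorem downTri_subset_iff {v : Vertex} {e : Edge} : downTri v ⊆ (Edge.lozenge e).verts ↔
    e = (v, 1) ∨ e = (v + (0, 1), 0) ∨ e = (v + (1, 1), 2) := by
  obtain ⟨⟨a, b⟩, i⟩ := e
  obtain ⟨c, d⟩ := v
  rcases fin_three_cases i with rfl | rfl | rfl <;>
  simp [downTri, Finset.insert_subset_iff, Edge.lozenge, Lozenge.verts, dir_zero, dir_one, dir_two,
      fin_three_one_add_one, fin_three_one_add_two, fin_three_two_add_one,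
      fin_three_two_add_two] <;>
  omega

/-- Besides the lozenge overlapping `e`, the candidates overlap one of the four other edges of the
two triangles at `e`. -/
theorem ends_subset_iff {e e' : Edge} : Edge.ends e ⊆ (Edge.lozenge e').verts ↔ e' = e ∨
    e' = (e.1 + dir e.2, e.2 + 1) ∨ e' = (e.1 - dir (e.2 + 2), e.2 + 2) ∨
    e' = (e.1 + dir e.2, e.2 + 2) ∨ e' = (e.1 - dir (e.2 + 1), e.2 + 1) := by
  obtain ⟨⟨a, b⟩, i⟩ := e
  obtain ⟨⟨a', b'⟩, i'⟩ := e'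
  rcases fin_three_cases i with rfl | rfl | rfl <;>
  rcases fin_three_cases i' with rfl | rfl | rfl <;>
  simp [Edge.ends, Edge.src, Edge.tgt, Finset.insert_subset_iff, Edge.lozenge, Lozenge.verts,
      dir_zero, dir_one, dir_two, fin_three_one_add_one, fin_three_one_add_two,
      fin_three_two_add_one, fin_three_two_add_two] <;>
  omega

open Classical in
/-- The change of the height function of `T` along an edge. -/
noncomputable def jump (T : Set Lozenge) (e : Edge) : ℤ := if Edge.lozenge e ∈ T then -2 else 1

theorem jump_cases (T : Set Lozenge) (e : Edge) :
    (Edge.lozenge e ∈ T ∧ jump T e = -2) ∨ (Edge.lozenge e ∉ T ∧ jump T e = 1) := by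
  by_cases h : Edge.lozenge e ∈ T <;> simp [jump, h]

/-- If `k` of the three lozenges are present, the jumps add up to `3 - 3 * k`, which vanishes only
for `k = 1`. -/
theorem existsUnique_lozenge_iff {T : Set Lozenge} {t : Finset Vertex} {a b c : Edge}
    (ht : ∀ e, t ⊆ (Edge.lozenge e).verts ↔ e = a ∨ e = b ∨ e = c)
    (hab : a ≠ b) (hac : a ≠ c) (hbc : b ≠ c) :
    (∃! L : Lozenge, L ∈ T ∧ t ⊆ L.verts) ↔ jump T a + jump T b + jump T c = 0 := by
  have key : (∃! L : Lozenge, L ∈ T ∧ t ⊆ L.verts) ↔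
      ∃! e : Edge, Edge.lozenge e ∈ T ∧ (e = a ∨ e = b ∨ e = c) := by
    constructor
    · rintro ⟨L, ⟨hL, hs⟩, hu⟩
      obtain ⟨e, rfl⟩ := lozenge_surj L
      exact ⟨e, ⟨hL, (ht e).1 hs⟩, fun e' h' => lozenge_inj.1 (hu _ ⟨h'.1, (ht e').2 h'.2⟩)⟩
    · rintro ⟨e, ⟨hL, hs⟩, hu⟩
      refine ⟨Edge.lozenge e, ⟨hL, (ht e).2 hs⟩, ?_⟩
      rintro L ⟨hL', hs'⟩
      obtain ⟨e', rfl⟩ := lozenge_surj L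
      exact lozenge_inj.2 (hu e' ⟨hL', (ht e').1 hs'⟩)
  rw [key]
  constructor
  · rintro ⟨e, ⟨hL, he⟩, hu⟩
    have ha := fun h => hu a ⟨h, .inl rfl⟩
    have hb := fun h => hu b ⟨h, .inr (.inl rfl)⟩
    have hc := fun h => hu c ⟨h, .inr (.inr rfl)⟩
    rcases jump_cases T a with ⟨h1, h1'⟩ | ⟨h1, h1'⟩ <;>
    rcases jump_cases T b with ⟨h2, h2'⟩ | ⟨h2, h2'⟩ <;>
    rcases jump_cases T c with ⟨h3, h3'⟩ | ⟨h3, h3'⟩ <;> grind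
  · intro h
    rcases jump_cases T a with ⟨h1, h1'⟩ | ⟨h1, h1'⟩ <;>
    rcases jump_cases T b with ⟨h2, h2'⟩ | ⟨h2, h2'⟩ <;>
    rcases jump_cases T c with ⟨h3, h3'⟩ | ⟨h3, h3'⟩ <;> try omega
    · exact ⟨a, ⟨h1, by simp⟩, by rintro e ⟨he, rfl | rfl | rfl⟩ <;> first | rfl | contradiction⟩
    · exact ⟨b, ⟨h2, by simp⟩, by rintro e ⟨he, rfl | rfl | rfl⟩ <;> first | rfl | contradiction⟩
    · exact ⟨c, ⟨h3, by simp⟩, by rintro e ⟨he, rfl | rfl | rfl⟩ <;> first | rfl | contradiction⟩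

/-- The values of `D` around every triangle add up to zero. -/
def Irrotational (D : Edge → ℤ) : Prop := ∀ v : Vertex,
  D (v, 0) + D (v + (1, 0), 1) + D (v + (1, 1), 2) = 0 ∧
  D (v, 1) + D (v + (0, 1), 0) + D (v + (1, 1), 2) = 0

theorem isTiling_iff {T : Set Lozenge} : IsTiling T ↔ Irrotational (jump T) := by
  have hup := fun v => existsUnique_lozenge_iff (T := T) (fun e => upTri_subset_iff (v := v) (e := e))
    (by simp) (by simp) (by simp)
  have hdown := fun v => existsUnique_lozenge_iff (T := T)
    (fun e => downTri_subset_iff (v := v) (e := e)) (by simp) (by simp) (by simp)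
  constructor
  · exact fun h v => ⟨(hup v).1 (h _ (upTri_mem v)), (hdown v).1 (h _ (downTri_mem v))⟩
  · intro h t ht
    obtain ⟨v, rfl | rfl⟩ := mem_triangles ht
    · exact (hup v).2 (h v).1
    · exact (hdown v).2 (h v).2

/-- `h` changes by `D` along the edges. -/
def IsPotential (D : Edge → ℤ) (h : Vertex → ℤ) : Prop :=
  ∀ v i, h (v + dir i) - h v = D (v, i)

theorem exists_primitive (f : ℤ → ℤ) : ∃ F : ℤ → ℤ, F 0 = 0 ∧ ∀ n, F (n + 1) = F n + f n := by
  refine ⟨fun n => match n with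
    | Int.ofNat n => ∑ i ∈ Finset.range n, f i
    | Int.negSucc n => -∑ i ∈ Finset.range (n + 1), f (-(i + 1)), rfl, ?_⟩
  rintro (n | n)
  · exact Finset.sum_range_succ (fun i : ℕ => f i) n
  · cases n with
    | zero => simp [Int.negSucc_eq]
    | succ n =>
      have : Int.negSucc (n + 1) + 1 = Int.negSucc n := by lia
      rw [this]
      simp only [Finset.sum_range_succ _ (n + 1)]
      rw [show Int.negSucc (n + 1) = -(((n + 1 : ℕ) : ℤ) + 1) by lia]
      lia

/-- Discrete Poincaré lemma: integrate along the row `b = 0`, then along columns, and check the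
other two directions with the triangle relations. -/
theorem Irrotational.exists_isPotential {D : Edge → ℤ} (hD : Irrotational D) :
    ∃ h, IsPotential D h := by
  obtain ⟨G, -, hG⟩ := exists_primitive fun a => D ((a, 0), 0)
  choose H hH0 hH using fun a => exists_primitive fun b => D ((a, b), 1)
  have h0 : ∀ a b : ℤ, G (a + 1) + H (a + 1) b = G a + H a b + D ((a, b), 0) := by
    intro a b
    -- The two triangles of a unit square share its diagonal. Subtracting their relations shows that
    -- the defect of the horizontal relation does not depend on `b`; it vanishes at `b = 0`.
    have step : ∀ b : ℤ, H (a + 1) (b + 1) - H a (b + 1) - D ((a, b + 1), 0) =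
        H (a + 1) b - H a b - D ((a, b), 0) := by
      intro b
      have := hD (a, b)
      simp only [Prod.mk_add_mk, add_zero] at this
      rw [hH, hH]
      lia
    induction b using Int.induction_on with
    | zero => rw [hG, hH0, hH0]; ring
    | succ b ih => have := step b; lia
    | pred b ih =>
      have := step (-b - 1)
      rw [sub_add_cancel] at this
      lia
  refine ⟨fun v => G v.1 + H v.1 v.2, ?_⟩
  rintro ⟨a, b⟩ i
  rcases fin_three_cases i with rfl | rfl | rfl
  · simp only [dir_zero, Prod.mk_add_mk, add_zero, h0]; ring
  · simp only [dir_one, Prod.mk_add_mk, add_zero, hH]; ring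
  · simp only [dir_two, Prod.mk_add_mk, ← sub_eq_add_neg]
    have h1 := h0 (a - 1) (b - 1)
    have h2 := hH a (b - 1)
    have h3 := (hD (a - 1, b - 1)).1
    simp only [Prod.mk_add_mk, add_zero, sub_add_cancel] at h1 h2 h3
    lia

theorem IsPotential.irrotational {D : Edge → ℤ} {h : Vertex → ℤ} (hh : IsPotential D h) :
    Irrotational D := by
  rintro ⟨a, b⟩
  simp only [← hh _ _, dir_zero, dir_one, dir_two, Prod.mk_add_mk, add_zero, add_neg_cancel_right]
  constructor <;> ring

/-! ### The difference constraints of the grid -/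

/-- The first of the two common neighbours of the end points of an edge. -/
def Edge.sideA (e : Edge) : Vertex := e.1 - dir (e.2 + 1)

/-- The second of the two common neighbours of the end points of an edge. -/
def Edge.sideB (e : Edge) : Vertex := e.1 - dir (e.2 + 2)

theorem adj_ends_iff {e : Edge} {w : Vertex} :
    (Adj w e.src ∧ Adj w e.tgt) ↔ w = e.sideA ∨ w = e.sideB := by
  obtain ⟨⟨a, b⟩, i⟩ := e
  obtain ⟨c, d⟩ := w
  rcases fin_three_cases i with rfl | rfl | rfl <;>
  simp only [Edge.src, Edge.tgt, Edge.sideA, Edge.sideB, zero_add, dir_zero, dir_one, dir_two,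
      fin_three_one_add_one, fin_three_one_add_two, fin_three_two_add_one,
      fin_three_two_add_two, Prod.mk_add_mk, Prod.mk_sub_mk, adj_iff, Prod.mk.injEq] <;>
  omega

theorem sideA_ne_sideB (e : Edge) : e.sideA ≠ e.sideB := by
  obtain ⟨⟨a, b⟩, i⟩ := e
  rcases fin_three_cases i with rfl | rfl | rfl <;>
  simp [Edge.sideA, Edge.sideB, dir_zero, dir_one, dir_two,
      fin_three_one_add_one, fin_three_one_add_two, fin_three_two_add_one,
      fin_three_two_add_two]

theorem mem_DC_edges {X₁ X₂ : Finset Edge} {a : Vertex × Vertex × ℤ} :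
    a ∈ (DC X₁ X₂).edges ↔ (∃ e : Edge, a = (e.src, e.tgt, 1)) ∨
      (∃ e ∈ X₁ ∪ X₂, a = (e.tgt, e.src, -1)) ∨
      ∃ e ∈ X₂, a = (e.sideA, e.sideB, 0) ∨ a = (e.sideB, e.sideA, 0) := by
  simp only [DC, Set.mem_union, Set.mem_ofPred_eq, or_assoc]
  refine or_congr_right (or_congr_right (exists_congr fun e => and_congr_right fun _ => ?_))
  constructor
  · rintro ⟨w, w', hne, h1, h2, h3, h4, rfl⟩
    have hw := adj_ends_iff.1 ⟨h1, h2⟩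
    have hw' := adj_ends_iff.1 ⟨h3, h4⟩
    rcases hw with rfl | rfl <;> rcases hw' with rfl | rfl <;> simp_all
  · have hA := adj_ends_iff.2 (Or.inl rfl : e.sideA = e.sideA ∨ _)
    have hB := adj_ends_iff.2 (Or.inr rfl : e.sideB = e.sideA ∨ _)
    have hne := sideA_ne_sideB e
    rintro (rfl | rfl)
    · exact ⟨_, _, hne, hA.1, hA.2, hB.1, hB.2, rfl⟩
    · exact ⟨_, _, hne.symm, hB.1, hB.2, hA.1, hA.2, rfl⟩

theorem DC_solves_iff {X₁ X₂ : Finset Edge} {h : Vertex → ℤ} : (DC X₁ X₂).Solves h ↔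
    (∀ v i, h (v + dir i) - h v ≤ 1) ∧ (∀ e ∈ X₁ ∪ X₂, h e.src - h e.tgt ≤ -1) ∧
      ∀ e ∈ X₂, h e.sideA = h e.sideB := by
  constructor
  · intro hs
    refine ⟨fun v i => hs _ _ _ (mem_DC_edges.2 (.inl ⟨(v, i), rfl⟩)),
      fun e he => hs _ _ _ (mem_DC_edges.2 (.inr (.inl ⟨e, he, rfl⟩))), fun e he => ?_⟩
    have h1 := hs _ _ _ (mem_DC_edges.2 (.inr (.inr ⟨e, he, .inl rfl⟩)))
    have h2 := hs _ _ _ (mem_DC_edges.2 (.inr (.inr ⟨e, he, .inr rfl⟩)))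
    lia
  · rintro ⟨h1, h2, h3⟩ u v w hw
    rcases mem_DC_edges.1 hw with ⟨e, he⟩ | ⟨e, hX, he⟩ | ⟨e, hX, he | he⟩ <;>
    obtain ⟨rfl, rfl, rfl⟩ := by simpa using he
    · exact h1 _ _
    · exact h2 _ hX
    · rw [h3 _ hX, sub_self]
    · rw [h3 _ hX, sub_self]

theorem dir_add_dir (i : Fin 3) : dir i + dir (i + 1) = -dir (i + 2) := by
  rcases fin_three_cases i with rfl | rfl | rfl <;> decide

theorem dir_ne_zero (i : Fin 3) : dir i ≠ 0 := by
  rcases fin_three_cases i with rfl | rfl | rfl <;> decide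

/-- Heights around the two triangles at `e`. On the side of `sideB` the directions after `e` come in
the order `i + 1`, `i + 2`, on the side of `sideA` in the opposite order. -/
theorem IsPotential.sides {D : Edge → ℤ} {h : Vertex → ℤ} (hh : IsPotential D h) (e : Edge) :
    h e.tgt - h e.src = D e ∧
    h e.sideB - h e.tgt = D (e.1 + dir e.2, e.2 + 1) ∧
    h e.src - h e.sideB = D (e.1 - dir (e.2 + 2), e.2 + 2) ∧
    h e.sideA - h e.tgt = D (e.1 + dir e.2, e.2 + 2) ∧
    h e.src - h e.sideA = D (e.1 - dir (e.2 + 1), e.2 + 1) := by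
  obtain ⟨v, i⟩ := e
  have hB : v - dir (i + 2) = v + dir i + dir (i + 1) := by
    rw [add_assoc, dir_add_dir]; abel
  have hA : v - dir (i + 1) = v + dir i + dir (i + 2) := by
    rw [add_assoc, eq_comm, sub_eq_add_neg]
    have : dir i + dir (i + 2) + dir (i + 1) = 0 := by
      rw [add_right_comm, dir_add_dir]; simp
    rw [eq_neg_of_add_eq_zero_left this]
  refine ⟨hh _ _, ?_, ?_, ?_, ?_⟩
  · rw [← hh]; simp only [Edge.sideB, Edge.tgt, hB]
  · rw [← hh]; simp only [Edge.sideB, Edge.src, sub_add_cancel]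
  · rw [← hh]; simp only [Edge.sideA, Edge.tgt, hA]
  · rw [← hh]; simp only [Edge.sideA, Edge.src, sub_add_cancel]

/-- When `e` is not overlapped, each of its two triangles has exactly one other edge of jump `-2`.
Equal heights at `sideA` and `sideB` mean equal jumps from `e.tgt` to them. These two edges have
different directions, so equality says that the two adjacent lozenges have different orientations.
-/
theorem salient_iff {T : Set Lozenge} {h : Vertex → ℤ} (hh : IsPotential (jump T) h) {e : Edge}
    (he : Edge.lozenge e ∉ T) :
    (∀ L ∈ T, ∀ L' ∈ T, L ≠ L' → Edge.ends e ⊆ L.verts → Edge.ends e ⊆ L'.verts →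
      L.normal ≠ L'.normal) ↔ h e.sideA = h e.sideB := by
  obtain ⟨h0, h1, h2, h3, h4⟩ := hh.sides e
  have hj : jump T e = 1 := by simp [jump, he]
  have hne : ∀ i : Fin 3, i + 1 ≠ i + 2 := by decide
  constructor
  · intro hs
    -- Two distinct lozenges of one orientation at `e` are excluded; `ha` and `hb` apply this to
    -- directions `i + 1` and `i + 2`.
    have hs' : ∀ p q : Edge, Edge.ends e ⊆ (Edge.lozenge p).verts →
        Edge.ends e ⊆ (Edge.lozenge q).verts → p ≠ q → p.2 = q.2 → Edge.lozenge p ∈ T →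
        Edge.lozenge q ∉ T := fun p q hp hq hpq h2 hpT hqT =>
      hs _ hpT _ hqT (mt lozenge_inj.1 hpq) hp hq h2
    have ha := hs' (e.1 + dir e.2, e.2 + 1) (e.1 - dir (e.2 + 1), e.2 + 1)
      (ends_subset_iff.2 (by simp)) (ends_subset_iff.2 (by simp))
      (by
        simp only [ne_eq, Prod.mk.injEq, and_true]
        rw [← sub_eq_zero, add_sub_sub_cancel, dir_add_dir]
        simpa using dir_ne_zero _) rfl
    have hb := hs' (e.1 + dir e.2, e.2 + 2) (e.1 - dir (e.2 + 2), e.2 + 2)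
      (ends_subset_iff.2 (by simp)) (ends_subset_iff.2 (by simp))
      (by
        simp only [ne_eq, Prod.mk.injEq, and_true]
        rw [← sub_eq_zero, add_sub_sub_cancel]
        have : ∀ i : Fin 3, dir i + dir (i + 2) ≠ 0 := by decide
        exact this _) rfl
    rcases jump_cases T (e.1 + dir e.2, e.2 + 1) with ⟨g1, g1'⟩ | ⟨g1, g1'⟩ <;>
    rcases jump_cases T (e.1 - dir (e.2 + 2), e.2 + 2) with ⟨g2, g2'⟩ | ⟨g2, g2'⟩ <;>
    rcases jump_cases T (e.1 + dir e.2, e.2 + 2) with ⟨g3, g3'⟩ | ⟨g3, g3'⟩ <;>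
    rcases jump_cases T (e.1 - dir (e.2 + 1), e.2 + 1) with ⟨g4, g4'⟩ | ⟨g4, g4'⟩ <;>
    lia
  · intro hAB L hL L' hL' hLL hs hs' hn
    obtain ⟨p, rfl⟩ := lozenge_surj L
    obtain ⟨q, rfl⟩ := lozenge_surj L'
    have hp : jump T p = -2 := by simp [jump, hL]
    have hq : jump T q = -2 := by simp [jump, hL']
    have hne' := hne e.2
    rcases ends_subset_iff.1 hs with rfl | rfl | rfl | rfl | rfl
    · exact he hL
    all_goals
      rcases ends_subset_iff.1 hs' with rfl | rfl | rfl | rfl | rfl <;>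
      first
      | exact he hL'
      | exact hLL rfl
      | exact hne' hn
      | exact hne' hn.symm
      | lia

theorem nonoverlap_iff {T : Set Lozenge} {e : Edge} :
    (∀ L ∈ T, ¬ L.Overlaps e) ↔ Edge.lozenge e ∉ T := by
  constructor
  · exact fun h hT => h _ hT (overlaps_iff.2 rfl)
  · intro h L hL ho
    obtain ⟨p, rfl⟩ := lozenge_surj L
    exact h (overlaps_iff.1 ho ▸ hL)

theorem Tilable.feasible {X₁ X₂ : Finset Edge} (hT : Tilable X₁ X₂) : (DC X₁ X₂).Feasible := by
  obtain ⟨T, ht, hn, hs⟩ := hT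
  obtain ⟨h, hh⟩ := (isTiling_iff.1 ht).exists_isPotential
  refine ⟨h, DC_solves_iff.2 ⟨fun v i => ?_, fun e he => ?_, fun e he => ?_⟩⟩
  · rw [hh v i]
    rcases jump_cases T (v, i) with ⟨_, h1⟩ | ⟨_, h1⟩ <;> lia
  · have h1 := (hh.sides e).1
    rw [jump, if_neg (nonoverlap_iff.1 (hn e he))] at h1
    lia
  · exact (salient_iff hh (nonoverlap_iff.1 (hn e (Finset.mem_union_right _ he)))).1 (hs e he)

/-- The largest function below `h` whose value at `(a, b)` is congruent to `a + b` modulo `3`. -/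
def roundHeight (h : Vertex → ℤ) (v : Vertex) : ℤ := v.1 + v.2 + 3 * ((h v - (v.1 + v.2)) / 3)

/-- Rounding down to a residue class is monotone and commutes with adding `w` when the classes of
the two end points differ by `w`. -/
theorem roundHeight_le {h : Vertex → ℤ} {u v : Vertex} {w : ℤ} (hle : h v - h u ≤ w)
    (hw : 3 ∣ v.1 + v.2 - (u.1 + u.2) - w) : roundHeight h v - roundHeight h u ≤ w := by
  unfold roundHeight
  omega

theorem tilable_of_feasible {X₁ X₂ : Finset Edge} (hF : (DC X₁ X₂).Feasible) : Tilable X₁ X₂ := by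
  obtain ⟨g, hg⟩ := hF
  obtain ⟨hg1, hg2, hg3⟩ := DC_solves_iff.1 hg
  let h := roundHeight g
  have hdir : ∀ i, (dir i).1 + (dir i).2 = 1 ∨ (dir i).1 + (dir i).2 = -2 := by decide
  have h1 : ∀ v i, h (v + dir i) - h v ≤ 1 := fun v i =>
    roundHeight_le (hg1 v i) (by have := hdir i; simp only [Prod.fst_add, Prod.snd_add]; omega)
  have h2 : ∀ e ∈ X₁ ∪ X₂, h e.src - h e.tgt ≤ -1 := fun e he =>
    roundHeight_le (hg2 e he) (by
      have := hdir e.2; simp only [Edge.src, Edge.tgt, Prod.fst_add, Prod.snd_add]; omega)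
  have hc : ∀ e : Edge, (3 : ℤ) ∣ e.sideB.1 + e.sideB.2 - (e.sideA.1 + e.sideA.2) := fun e => by
    have h1 := hdir (e.2 + 1)
    have h2 := hdir (e.2 + 2)
    simp only [Edge.sideA, Edge.sideB, Prod.fst_sub, Prod.snd_sub]
    omega
  have h3 : ∀ e ∈ X₂, h e.sideA = h e.sideB := fun e he => by
    have h4 := hg3 e he
    have h5 := hc e
    have h6 : h e.sideB - h e.sideA ≤ 0 := roundHeight_le (by lia) (by omega)
    have h7 : h e.sideA - h e.sideB ≤ 0 := roundHeight_le (by lia) (by omega)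
    lia
  have hmod : ∀ v i, (3 : ℤ) ∣ h (v + dir i) - h v - 1 := fun v i => by
    have := hdir i
    simp only [h, roundHeight, Prod.fst_add, Prod.snd_add]
    omega
  -- A jump is at most `1` and congruent to `1` modulo `3`. The other two jumps around a triangle
  -- are at most `1` as well, so it is at least `-2`.
  have hval : ∀ v i, h (v + dir i) - h v = 1 ∨ h (v + dir i) - h v = -2 := fun v i => by
    have e1 := h1 v i
    have e2 := h1 (v + dir i) (i + 1)
    have e3 := h1 (v + dir i + dir (i + 1)) (i + 2)
    have e4 : v + dir i + dir (i + 1) + dir (i + 2) = v := by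
      rw [add_assoc v, dir_add_dir]; abel
    rw [e4] at e3
    have e5 := hmod v i
    omega
  let T : Set Lozenge := {L | h L.base - h (L.base - dir L.normal) = -2}
  have hmem : ∀ e : Edge, Edge.lozenge e ∈ T ↔ h e.tgt - h e.src = -2 := fun e => by
    simp [T, Edge.lozenge, Edge.tgt, Edge.src]
  have hpot : IsPotential (jump T) h := fun v i => by
    have e1 := hmem (v, i)
    simp only [Edge.tgt, Edge.src] at e1
    rcases jump_cases T (v, i) with ⟨e2, e3⟩ | ⟨e2, e3⟩
    · rw [e3, e1.1 e2]
    · rw [e3]; exact (hval v i).resolve_right (mt e1.2 e2)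
  have hno : ∀ e ∈ X₁ ∪ X₂, Edge.lozenge e ∉ T := fun e he => by
    rw [hmem]; have := h2 e he; lia
  exact ⟨T, isTiling_iff.2 hpot.irrotational, fun e he => nonoverlap_iff.2 (hno e he), fun e he =>
    (salient_iff hpot (hno e (Finset.mem_union_right _ he))).2 (h3 e he)⟩

theorem tilable_iff_feasible {X₁ X₂ : Finset Edge} : Tilable X₁ X₂ ↔ (DC X₁ X₂).Feasible :=
  ⟨Tilable.feasible, tilable_of_feasible⟩

/-! ### Distances in the positive graph -/

/-- The distance in the positive graph. -/
def gridDist (u v : Vertex) : ℤ :=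
  (v.1 - u.1) + (v.2 - u.2) - 3 * min (v.1 - u.1) (min (v.2 - u.2) 0)

theorem gridDist_self (u : Vertex) : gridDist u u = 0 := by simp [gridDist]

theorem gridDist_triangle (u v w : Vertex) : gridDist u w ≤ gridDist u v + gridDist v w := by
  unfold gridDist; omega

theorem gridDist_add_dir (v : Vertex) (i : Fin 3) : gridDist v (v + dir i) = 1 := by
  rcases fin_three_cases i with rfl | rfl | rfl <;> simp [gridDist, dir_zero, dir_one, dir_two]

theorem mem_posGraph_edges {X₁ X₂ : Finset Edge} {a : Vertex × Vertex × ℤ} :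
    a ∈ (posGraph X₁ X₂).edges ↔ ∃ v i, a = (v, v + dir i, 1) := by
  simp only [posGraph, WDigraph.filterWeight, Set.mem_ofPred_eq, mem_DC_edges]
  constructor
  · rintro ⟨⟨e, rfl⟩ | ⟨e, -, rfl⟩ | ⟨e, -, rfl | rfl⟩, h⟩
    · exact ⟨e.1, e.2, rfl⟩
    all_goals simp at h
  · rintro ⟨v, i, rfl⟩
    exact ⟨.inl ⟨(v, i), rfl⟩, one_pos⟩

theorem mem_posGraph_verts {X₁ X₂ : Finset Edge} (v : Vertex) : v ∈ (posGraph X₁ X₂).verts :=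
  ⟨v, v + dir 0, 1, mem_DC_edges.2 (.inl ⟨(v, 0), rfl⟩), one_pos, .inl rfl⟩

theorem gridDist_le_of_walk {X₁ X₂ : Finset Edge} {u v : Vertex} {c : ℤ}
    (h : (posGraph X₁ X₂).Walk u v c) : gridDist u v ≤ c := by
  induction h with
  | nil => rw [gridDist_self]
  | @cons u v x w c he _ ih =>
    obtain ⟨a, i, ha⟩ := mem_posGraph_edges.1 he
    obtain ⟨rfl, rfl, rfl⟩ := by simpa using ha
    have := gridDist_triangle u (u + dir i) x
    rw [gridDist_add_dir] at this
    lia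

theorem walk_nsmul_dir {X₁ X₂ : Finset Edge} (i : Fin 3) {u v : Vertex} {c : ℤ} (n : ℕ)
    (h : (posGraph X₁ X₂).Walk (u + n • dir i) v c) : (posGraph X₁ X₂).Walk u v (n + c) := by
  induction n generalizing u with
  | zero => simpa using h
  | succ n ih =>
    have h1 : (posGraph X₁ X₂).Walk (u + dir i) v (n + c) :=
      ih (by rwa [add_assoc, add_comm (dir i), ← succ_nsmul])
    have h2 := WDigraph.Walk.cons (mem_posGraph_edges.2 ⟨u, i, rfl⟩) h1
    convert h2 using 1
    push_cast; ring

/-- Among the lifts of `v - u` to `ℤ³`, the one with nonnegative coordinates and least coordinate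
zero has coordinate sum `gridDist u v`, and walking along it attains this length. The triangle
inequality for `gridDist` bounds every walk from below. -/
theorem isDist_posGraph (X₁ X₂ : Finset Edge) (u v : Vertex) :
    (posGraph X₁ X₂).IsDist u v (gridDist u v) := by
  refine ⟨?_, fun c hc => gridDist_le_of_walk hc⟩
  -- Subtracting `m` from all coordinates of the lift `(v.1 - u.1, v.2 - u.2, 0)` gives the numbers
  -- of steps in the three directions.
  obtain ⟨m, hm⟩ : ∃ m, m = min (v.1 - u.1) (min (v.2 - u.2) 0) := ⟨_, rfl⟩
  have h := walk_nsmul_dir (X₁ := X₁) (X₂ := X₂) (u := u) 0 (v.1 - u.1 - m).toNat <|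
    walk_nsmul_dir 1 (v.2 - u.2 - m).toNat <| walk_nsmul_dir 2 (-m).toNat <|
    .nil (mem_posGraph_verts _)
  have hv : u + (v.1 - u.1 - m).toNat • dir 0 + (v.2 - u.2 - m).toNat • dir 1 +
      (-m).toNat • dir 2 = v := by
    rw [dir_zero, dir_one, dir_two]
    ext <;> simp <;> omega
  rw [hv] at h
  change (posGraph X₁ X₂).Walk u v (gridDist u v)
  convert h using 1
  unfold gridDist
  omega

theorem isDist_posGraph_iff {X₁ X₂ : Finset Edge} {u v : Vertex} {d : ℤ} :
    (posGraph X₁ X₂).IsDist u v d ↔ d = gridDist u v :=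
  ⟨fun h => h.unique (isDist_posGraph X₁ X₂ u v), fun h => h ▸ isDist_posGraph X₁ X₂ u v⟩

/-! ### The graph `G⁺⁻` -/

theorem mem_negGraph_edges {X₁ X₂ : Finset Edge} {a : Vertex × Vertex × ℤ} :
    a ∈ (negGraph X₁ X₂).edges ↔ (∃ e ∈ X₁ ∪ X₂, a = (e.tgt, e.src, -1)) ∨
      ∃ e ∈ X₂, a = (e.sideA, e.sideB, 0) ∨ a = (e.sideB, e.sideA, 0) := by
  simp only [negGraph, WDigraph.filterWeight, Set.mem_ofPred_eq, mem_DC_edges]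
  constructor
  · rintro ⟨⟨e, rfl⟩ | h, h'⟩
    · simp at h'
    · exact h
  · intro h
    refine ⟨.inr h, ?_⟩
    rcases h with ⟨e, -, rfl⟩ | ⟨e, -, rfl | rfl⟩ <;> simp

theorem mem_posNegGraph_verts {X₁ X₂ : Finset Edge} {v : Vertex} :
    v ∈ (posNegGraph X₁ X₂).verts ↔ (∃ e ∈ X₁ ∪ X₂, v = e.src ∨ v = e.tgt) ∨
      ∃ e ∈ X₂, v = e.sideA ∨ v = e.sideB := by
  have : v ∈ (posNegGraph X₁ X₂).verts ↔
      ∃ a b w, (a, b, w) ∈ (negGraph X₁ X₂).edges ∧ (v = a ∨ v = b) := by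
    simp only [posNegGraph, negGraph, WDigraph.filterWeight, Set.mem_ofPred_eq, and_assoc]
  simp only [this, mem_negGraph_edges]
  constructor
  · rintro ⟨a, b, w, ⟨e, he, h⟩ | ⟨e, he, h | h⟩, hv⟩ <;>
    obtain ⟨rfl, rfl, rfl⟩ := by simpa using h
    · exact .inl ⟨e, he, hv.symm⟩
    · exact .inr ⟨e, he, hv⟩
    · exact .inr ⟨e, he, hv.symm⟩
  · rintro (⟨e, he, h⟩ | ⟨e, he, h⟩)
    · exact ⟨_, _, _, .inl ⟨e, he, rfl⟩, h.symm⟩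
    · exact ⟨_, _, _, .inr ⟨e, he, .inl rfl⟩, h⟩

theorem mem_posNegGraph_edges {X₁ X₂ : Finset Edge} {u v : Vertex} {w : ℤ} :
    (u, v, w) ∈ (posNegGraph X₁ X₂).edges ↔ (u, v, w) ∈ (negGraph X₁ X₂).edges ∨
      (u ∈ (posNegGraph X₁ X₂).verts ∧ v ∈ (posNegGraph X₁ X₂).verts ∧ u ≠ v ∧
        w = gridDist u v) := by
  simp only [posNegGraph, Set.mem_union, Set.mem_ofPred_eq, isDist_posGraph_iff]

theorem posNegGraph_verts_finite (X₁ X₂ : Finset Edge) : (posNegGraph X₁ X₂).verts.Finite := by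
  have : (posNegGraph X₁ X₂).verts ⊆ ((X₁ ∪ X₂).image Edge.src ∪ (X₁ ∪ X₂).image Edge.tgt ∪
      (X₂.image Edge.sideA ∪ X₂.image Edge.sideB) : Finset Vertex) := by
    intro v hv
    simp only [Finset.coe_union, Finset.coe_image, Set.mem_union, Set.mem_image, Finset.mem_coe]
    rcases mem_posNegGraph_verts.1 hv with ⟨e, he, rfl | rfl⟩ | ⟨e, he, rfl | rfl⟩
    · exact .inl (.inl ⟨e, by simpa using he, rfl⟩)
    · exact .inl (.inr ⟨e, by simpa using he, rfl⟩)
    · exact .inr (.inl ⟨e, he, rfl⟩)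
    · exact .inr (.inr ⟨e, he, rfl⟩)
  exact (Finset.finite_toSet _).subset this

theorem posNegGraph_closed (X₁ X₂ : Finset Edge) : (posNegGraph X₁ X₂).Closed := by
  intro u v w hw
  rcases mem_posNegGraph_edges.1 hw with h | h
  · exact ⟨⟨u, v, w, h.1, h.2, .inl rfl⟩, ⟨u, v, w, h.1, h.2, .inr rfl⟩⟩
  · exact ⟨h.1, h.2.1⟩

theorem posNegGraph_edges_finite (X₁ X₂ : Finset Edge) : (posNegGraph X₁ X₂).edges.Finite := by
  have hV := posNegGraph_verts_finite X₁ X₂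
  refine ((((hV.prod hV).prod (Set.toFinite ({-1, 0} : Set ℤ))).image
    fun a => (a.1.1, a.1.2, a.2)).union
    ((hV.prod hV).image fun a => (a.1, a.2, gridDist a.1 a.2))).subset ?_
  rintro ⟨u, v, w⟩ hw
  obtain ⟨hu, hv⟩ := posNegGraph_closed X₁ X₂ u v w hw
  rcases mem_posNegGraph_edges.1 hw with h | ⟨-, -, -, rfl⟩
  · refine .inl ⟨((u, v), w), ⟨⟨hu, hv⟩, ?_⟩, rfl⟩
    rcases mem_negGraph_edges.1 h with ⟨e, -, h⟩ | ⟨e, -, h | h⟩ <;> simp_all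
  · exact .inr ⟨(u, v), ⟨hu, hv⟩, rfl⟩

theorem posNegGraph_solves_iff {X₁ X₂ : Finset Edge} {h : Vertex → ℤ} :
    (posNegGraph X₁ X₂).Solves h ↔
      (∀ u ∈ (posNegGraph X₁ X₂).verts, ∀ v ∈ (posNegGraph X₁ X₂).verts,
        h v - h u ≤ gridDist u v) ∧
      (∀ e ∈ X₁ ∪ X₂, h e.src - h e.tgt ≤ -1) ∧ ∀ e ∈ X₂, h e.sideA = h e.sideB := by
  constructor
  · intro hs
    refine ⟨fun u hu v hv => ?_, fun e he => hs _ _ _ (mem_posNegGraph_edges.2 (.inl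
      (mem_negGraph_edges.2 (.inl ⟨e, he, rfl⟩)))), fun e he => ?_⟩
    · by_cases huv : u = v
      · rw [huv, gridDist_self, sub_self]
      · exact hs _ _ _ (mem_posNegGraph_edges.2 (.inr ⟨hu, hv, huv, rfl⟩))
    · have h1 := hs _ _ _ (mem_posNegGraph_edges.2 (.inl
        (mem_negGraph_edges.2 (.inr ⟨e, he, .inl rfl⟩))))
      have h2 := hs _ _ _ (mem_posNegGraph_edges.2 (.inl
        (mem_negGraph_edges.2 (.inr ⟨e, he, .inr rfl⟩))))
      lia
  · rintro ⟨h1, h2, h3⟩ u v w hw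
    rcases mem_posNegGraph_edges.1 hw with h | ⟨hu, hv, -, rfl⟩
    · rcases mem_negGraph_edges.1 h with ⟨e, hX, he⟩ | ⟨e, hX, he | he⟩ <;>
      obtain ⟨rfl, rfl, rfl⟩ := by simpa using he
      · exact h2 _ hX
      · rw [h3 _ hX, sub_self]
      · rw [h3 _ hX, sub_self]
    · exact h1 u hu v hv

theorem sub_le_gridDist {X₁ X₂ : Finset Edge} {h : Vertex → ℤ}
    (h1 : ∀ v i, h (v + dir i) - h v ≤ 1) (u v : Vertex) : h v - h u ≤ gridDist u v := by
  have key : ∀ c, (posGraph X₁ X₂).Walk u v c → h v - h u ≤ c := by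
    intro c hc
    induction hc with
    | nil => simp
    | @cons u v x w c he _ ih =>
      obtain ⟨a, i, ha⟩ := mem_posGraph_edges.1 he
      obtain ⟨rfl, rfl, rfl⟩ := by simpa using ha
      have := h1 u i
      lia
  exact key _ (isDist_posGraph X₁ X₂ u v).1

/-- Restriction is immediate from the meaning of distance. For the converse, the McShane-type
extension by a minimum over the finite vertex set satisfies the positive constraints everywhere and
agrees with `g` on that set, where all other constraints live. -/
theorem feasible_iff_posNegGraph_feasible {X₁ X₂ : Finset Edge} :
    (DC X₁ X₂).Feasible ↔ (posNegGraph X₁ X₂).Feasible := by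
  constructor
  · rintro ⟨h, hs⟩
    obtain ⟨h1, h2, h3⟩ := DC_solves_iff.1 hs
    exact ⟨h, posNegGraph_solves_iff.2
      ⟨fun u _ v _ => sub_le_gridDist (X₁ := X₁) (X₂ := X₂) h1 u v, h2, h3⟩⟩
  · rintro ⟨g, hs⟩
    obtain ⟨h1, h2, h3⟩ := posNegGraph_solves_iff.1 hs
    set V := (posNegGraph_verts_finite X₁ X₂).toFinset with hV
    have hmem : ∀ {v}, v ∈ V ↔ v ∈ (posNegGraph X₁ X₂).verts := by simp [hV]
    -- The minimum needs a nonempty index set; with no vertices there are no constrained edges, and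
    -- a constant works.
    rcases V.eq_empty_or_nonempty with he | hne
    · have hno : ∀ e, e ∉ X₁ ∪ X₂ := fun e hX => by
        have := hmem.2 (mem_posNegGraph_verts.2 (.inl ⟨e, hX, .inl rfl⟩))
        simp [he] at this
      exact ⟨fun _ => 0, DC_solves_iff.2 ⟨by simp, fun e hX => absurd hX (hno e), fun _ _ => rfl⟩⟩
    · let h : Vertex → ℤ := fun v => V.inf' hne fun u => g u + gridDist u v
      have hlip : ∀ u v, h v ≤ h u + gridDist u v := by
        intro u v
        obtain ⟨x, hx, hx'⟩ := V.exists_mem_eq_inf' hne fun x => g x + gridDist x u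
        have e1 : h v ≤ g x + gridDist x v := Finset.inf'_le _ hx
        have e2 : h u = g x + gridDist x u := hx'
        have := gridDist_triangle x u v
        lia
      have heq : ∀ v ∈ V, h v = g v := by
        intro v hv
        refine le_antisymm ?_ (Finset.le_inf' _ _ fun u hu => ?_)
        · have e1 : h v ≤ g v + gridDist v v := Finset.inf'_le _ hv
          rwa [gridDist_self, add_zero] at e1
        · have := h1 u (hmem.1 hu) v (hmem.1 hv)
          lia
      refine ⟨h, DC_solves_iff.2 ⟨fun v i => ?_, fun e hX => ?_, fun e hX => ?_⟩⟩
      · have := hlip v (v + dir i)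
        rw [gridDist_add_dir] at this
        lia
      · rw [heq _ (hmem.2 (mem_posNegGraph_verts.2 (.inl ⟨e, hX, .inl rfl⟩))),
          heq _ (hmem.2 (mem_posNegGraph_verts.2 (.inl ⟨e, hX, .inr rfl⟩)))]
        exact h2 e hX
      · rw [heq _ (hmem.2 (mem_posNegGraph_verts.2 (.inr ⟨e, hX, .inl rfl⟩))),
          heq _ (hmem.2 (mem_posNegGraph_verts.2 (.inr ⟨e, hX, .inr rfl⟩)))]
        exact h3 e hX

theorem isDist_proj (X₁ X₂ : Finset Edge) (x y z x' y' z' : ℤ) :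
    (posGraph X₁ X₂).IsDist (proj x y z) (proj x' y' z')
      ((x' - x) + (y' - y) + (z' - z) - 3 * min (x' - x) (min (y' - y) (z' - z))) := by
  rw [isDist_posGraph_iff]
  simp only [gridDist, proj]
  omega

/-! ### Reasoning about programs -/

/-- Started in `s`, the program `p` halts, and its running time and final state satisfy `Q`. -/
def wp (p : Prog) (s : State) (Q : ℕ → State → Prop) : Prop := ∃ t s', Exec p s t s' ∧ Q t s'

section wp

variable {s : State} {Q : ℕ → State → Prop}

theorem wp.mono {p : Prog} {Q' : ℕ → State → Prop} (h : wp p s Q) (hQ : ∀ t s', Q t s' → Q' t s') :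
    wp p s Q' := by
  obtain ⟨t, s', he, hq⟩ := h
  exact ⟨t, s', he, hQ _ _ hq⟩

@[simp] theorem wp_skip : wp .skip s Q ↔ Q 1 s :=
  ⟨by rintro ⟨_, _, ⟨⟩, h⟩; exact h, fun h => ⟨_, _, .skip _, h⟩⟩

@[simp] theorem wp_const {r : ℕ} {c : ℤ} : wp (.const r c) s Q ↔ Q 1 (s.setReg r c) :=
  ⟨by rintro ⟨_, _, ⟨⟩, h⟩; exact h, fun h => ⟨_, _, .const _ _ _, h⟩⟩

@[simp] theorem wp_add {r a b : ℕ} : wp (.add r a b) s Q ↔ Q 1 (s.setReg r (s.reg a + s.reg b)) :=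
  ⟨by rintro ⟨_, _, ⟨⟩, h⟩; exact h, fun h => ⟨_, _, .add _ _ _ _, h⟩⟩

@[simp] theorem wp_sub {r a b : ℕ} : wp (.sub r a b) s Q ↔ Q 1 (s.setReg r (s.reg a - s.reg b)) :=
  ⟨by rintro ⟨_, _, ⟨⟩, h⟩; exact h, fun h => ⟨_, _, .sub _ _ _ _, h⟩⟩

@[simp] theorem wp_load {r a : ℕ} : wp (.load r a) s Q ↔ Q 1 (s.setReg r (s.mem (s.reg a))) :=
  ⟨by rintro ⟨_, _, ⟨⟩, h⟩; exact h, fun h => ⟨_, _, .load _ _ _, h⟩⟩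

@[simp] theorem wp_store {a b : ℕ} : wp (.store a b) s Q ↔ Q 1 (s.setMem (s.reg a) (s.reg b)) :=
  ⟨by rintro ⟨_, _, ⟨⟩, h⟩; exact h, fun h => ⟨_, _, .store _ _ _, h⟩⟩

@[simp] theorem wp_seq {p q : Prog} :
    wp (.seq p q) s Q ↔ wp p s fun t s' => wp q s' fun t' s'' => Q (t + t') s'' :=
  ⟨by rintro ⟨_, _, ⟨⟩, h⟩; exact ⟨_, _, ‹_›, _, _, ‹_›, h⟩,
    fun ⟨_, _, h, _, _, h', hq⟩ => ⟨_, _, .seq h h', hq⟩⟩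

@[simp] theorem wp_ifPos {r : ℕ} {p q : Prog} : wp (.ifPos r p q) s Q ↔
    if 0 < s.reg r then wp p s (fun t => Q (t + 1)) else wp q s (fun t => Q (t + 1)) := by
  split_ifs with h
  · exact ⟨by rintro ⟨_, _, ⟨⟩ | ⟨⟩, hq⟩ <;> first | contradiction | exact ⟨_, _, ‹_›, hq⟩,
      fun ⟨_, _, he, hq⟩ => ⟨_, _, .ifTrue h he, hq⟩⟩
  · exact ⟨by rintro ⟨_, _, ⟨⟩ | ⟨⟩, hq⟩ <;> first | contradiction | exact ⟨_, _, ‹_›, hq⟩,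
      fun ⟨_, _, he, hq⟩ => ⟨_, _, .ifFalse h he, hq⟩⟩

/-- The invariant is indexed by the number of completed passes, so it fixes the number of passes as
`n`. Each costs its body plus one test, and the failing test costs one more step. -/
theorem wp_whilePos {r : ℕ} {p : Prog} (I : ℕ → State → Prop) (n B : ℕ)
    (hstep : ∀ k s, k < n → I k s → 0 < s.reg r ∧ wp p s fun t s' => t ≤ B ∧ I (k + 1) s')
    (hend : ∀ s, I n s → ¬ 0 < s.reg r) (h0 : I 0 s) :
    wp (.whilePos r p) s fun t s' => t ≤ n * (B + 1) + 1 ∧ I n s' := by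
  have key : ∀ m k s, k + m = n → I k s →
      wp (.whilePos r p) s fun t s' => t ≤ m * (B + 1) + 1 ∧ I n s' := by
    intro m
    induction m with
    | zero =>
      intro k s hk hI
      obtain rfl : k = n := hk
      exact ⟨_, _, .whileFalse (hend s hI), by simp, hI⟩
    | succ m ih =>
      intro k s hk hI
      obtain ⟨hpos, t, s', he, ht, hI'⟩ := hstep k s (by lia) hI
      obtain ⟨t', s'', he', ht', hI''⟩ := ih (k + 1) s' (by lia) hI'
      exact ⟨_, _, .whileTrue hpos he he', by rw [add_one_mul]; lia, hI''⟩
  exact key n 0 s (zero_add n) h0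

end wp

@[simp] theorem State.reg_setReg (s : State) (r k : ℕ) (x : ℤ) :
    (s.setReg r x).reg k = if k = r then x else s.reg k := Function.update_apply _ _ _ _

theorem State.reg_setReg_of_lt {r n k : ℕ} (h : r < n) (hk : n ≤ k) (s : State) (x : ℤ) :
    (s.setReg k x).reg r = s.reg r := Function.update_of_ne (by lia) _ _

@[simp] theorem State.mem_setReg (s : State) (r : ℕ) (x : ℤ) : (s.setReg r x).mem = s.mem := rfl

@[simp] theorem State.reg_setMem (s : State) (a x : ℤ) : (s.setMem a x).reg = s.reg := rfl

@[simp] theorem State.mem_setMem (s : State) (a x : ℤ) :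
    (s.setMem a x).mem = Function.update s.mem a x := rfl

/-- Sequential composition of a list of programs. -/
def Prog.block : List Prog → Prog
  | [] => .skip
  | p :: l => .seq p (Prog.block l)

@[simp] theorem wp_block_nil {s : State} {Q : ℕ → State → Prop} :
    wp (Prog.block []) s Q ↔ Q 1 s := wp_skip

@[simp] theorem wp_block_cons {p : Prog} {l : List Prog} {s : State} {Q : ℕ → State → Prop} :
    wp (Prog.block (p :: l)) s Q ↔
      wp p s fun t s' => wp (Prog.block l) s' fun t' s'' => Q (t + t') s'' := wp_seq

/-! ### One round of relaxation in memory -/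

/-- The state of a round that started from `f₀`, in which the edges of `P` have been relaxed. -/
structure Relaxed (G : WDigraph ℕ) (f₀ f : ℕ → ℤ) (flag : ℤ) (P : Set (ℕ × ℕ × ℤ)) : Prop where
  le : ∀ v ∈ G.verts, f v ≤ f₀ v
  lower : ∀ h, G.Solves h → (∀ v ∈ G.verts, h v ≤ f₀ v) → ∀ v ∈ G.verts, h v ≤ f v
  relaxed : ∀ u v w, (u, v, w) ∈ P → f v ≤ f₀ u + w
  flag : (flag = 0 ∧ ∀ v ∈ G.verts, f v = f₀ v) ∨ (flag = 1 ∧ ∃ v ∈ G.verts, f v < f₀ v)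

theorem Relaxed.of_le {G : WDigraph ℕ} {f₀ f : ℕ → ℤ} {flag w : ℤ} {P : Set (ℕ × ℕ × ℤ)} {i j : ℕ}
    (h : Relaxed G f₀ f flag P) (hi : i ∈ G.verts) (hle : f j ≤ f i + w) :
    Relaxed G f₀ f flag (insert (i, j, w) P) where
  le := h.le
  lower := h.lower
  flag := h.flag
  relaxed u v x hx := by
    rcases hx with hx | hx
    · obtain ⟨rfl, rfl, rfl⟩ := by simpa using hx
      have := h.le u hi
      lia
    · exact h.relaxed u v x hx

/-- A solution below `f` has `h j ≤ h i + w ≤ f i + w`, so the lower bound survives. `relaxed`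
compares with the initial `f₀` because values used in place may drop further; this is all that
`Round` needs. -/
theorem Relaxed.of_lt {G : WDigraph ℕ} {f₀ f : ℕ → ℤ} {flag w : ℤ} {P : Set (ℕ × ℕ × ℤ)} {i j : ℕ}
    (h : Relaxed G f₀ f flag P) (hi : i ∈ G.verts) (hj : j ∈ G.verts) (he : (i, j, w) ∈ G.edges)
    (hlt : f i + w < f j) :
    Relaxed G f₀ (Function.update f j (f i + w)) 1 (insert (i, j, w) P) := by
  have hle : ∀ v, Function.update f j (f i + w) v ≤ f v := fun v => by
    rw [Function.update_apply]; split_ifs with hv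
    · rw [hv]; exact hlt.le
    · exact le_rfl
  refine ⟨fun v hv => (hle v).trans (h.le v hv), fun g hg hg0 v hv => ?_, fun u v x hx => ?_,
    .inr ⟨rfl, j, hj, ?_⟩⟩
  · rw [Function.update_apply]
    split_ifs with hvj
    · have h1 := h.lower g hg hg0 i hi
      have h2 := hg i j w he
      rw [hvj]; lia
    · exact h.lower g hg hg0 v hv
  · rcases hx with hx | hx
    · obtain ⟨rfl, rfl, rfl⟩ := by simpa using hx
      rw [Function.update_self]
      have := h.le u hi
      lia
    · exact (hle v).trans (h.relaxed u v x hx)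
  · rw [Function.update_self]
    exact hlt.trans_le (h.le j hj)

/-- The values stored in the table at address `T`. -/
def valuesAt (m : ℤ → ℤ) (T : ℤ) (k : ℕ) : ℤ := m (T + 3 * k + 2)

/-- The table at address `T` holds the points `p k` for `k < M`. -/
def PointsAt (m : ℤ → ℤ) (T : ℤ) (M : ℕ) (p : ℕ → Vertex) : Prop :=
  ∀ k < M, m (T + 3 * k) = (p k).1 ∧ m (T + 3 * k + 1) = (p k).2

theorem valuesAt_update (m : ℤ → ℤ) (T x : ℤ) (j : ℕ) :
    valuesAt (Function.update m (T + 3 * j + 2) x) T = Function.update (valuesAt m T) j x := by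
  ext k
  simp only [valuesAt, Function.update_apply]
  congr 1
  simp only [eq_iff_iff]
  lia

theorem PointsAt.update {m : ℤ → ℤ} {T : ℤ} {M : ℕ} {p : ℕ → Vertex} (h : PointsAt m T M p) (x : ℤ)
    (j : ℕ) : PointsAt (Function.update m (T + 3 * j + 2) x) T M p := by
  intro k hk
  rw [Function.update_of_ne (by lia), Function.update_of_ne (by lia)]
  exact h k hk

/-- The graph on the entries of the table, four for each of `n` blocks. -/
def entryGraph (p : ℕ → Vertex) (n : ℕ) : WDigraph ℕ where
  verts := {k | k < 4 * n}
  edges := {a | ∃ i j : ℕ, i < 4 * n ∧ j < 4 * n ∧ a = (i, j, gridDist (p i) (p j))} ∪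
    {a | ∃ b < n, a = (4 * b + 1, 4 * b, -1) ∨ a = (4 * b + 2, 4 * b + 3, 0) ∨
      a = (4 * b + 3, 4 * b + 2, 0)}

/-- The invariant of a round that started from the values `f₀`. -/
structure RoundState (T : ℤ) (n : ℕ) (p : ℕ → Vertex) (f₀ : ℕ → ℤ) (P : Set (ℕ × ℕ × ℤ))
    (s : State) : Prop where
  table : s.reg 1 = T
  size : s.reg 2 = 4 * n
  points : PointsAt s.mem T (4 * n) p
  relaxed : Relaxed (entryGraph p n) f₀ (valuesAt s.mem T) (s.reg 9) P

theorem RoundState.congr {T : ℤ} {n : ℕ} {p : ℕ → Vertex} {f₀ : ℕ → ℤ} {P P' : Set (ℕ × ℕ × ℤ)}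
    {s s' : State} (h : RoundState T n p f₀ P s) (h1 : s'.reg 1 = s.reg 1)
    (h2 : s'.reg 2 = s.reg 2) (h9 : s'.reg 9 = s.reg 9) (hm : s'.mem = s.mem) (hP : P' ⊆ P) :
    RoundState T n p f₀ P' s' where
  table := h1.trans h.table
  size := h2.trans h.size
  points := hm ▸ h.points
  relaxed := by
    rw [h9, hm]
    exact { h.relaxed with relaxed := fun u v w hw => h.relaxed.relaxed u v w (hP hw) }

/-- Relax the edge of weight register `12` between the entries whose values are stored at the addresses
in the registers `10` and `11`; register `9` records a change. -/
def relaxEdge : Prog := .block [.load 13 10, .add 13 13 12, .load 14 11, .sub 14 14 13,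
  .ifPos 14 (.seq (.store 11 13) (.const 9 1)) .skip]

theorem wp_relaxEdge {T : ℤ} {n : ℕ} {p : ℕ → Vertex} {f₀ : ℕ → ℤ} {P : Set (ℕ × ℕ × ℤ)}
    {s : State} (h : RoundState T n p f₀ P s) {i j : ℕ} {w : ℤ} (hi : i < 4 * n) (hj : j < 4 * n)
    (he : (i, j, w) ∈ (entryGraph p n).edges) (h10 : s.reg 10 = T + 3 * i + 2)
    (h11 : s.reg 11 = T + 3 * j + 2) (h12 : s.reg 12 = w) :
    wp relaxEdge s fun t s' => t ≤ 8 ∧ RoundState T n p f₀ (insert (i, j, w) P) s' ∧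
      ∀ r < 9, s'.reg r = s.reg r := by
  have hv : ∀ k : ℕ, s.mem (T + 3 * k + 2) = valuesAt s.mem T k := fun k => rfl
  simp only [relaxEdge, wp_block_cons, wp_load, wp_add, wp_sub, wp_ifPos, wp_seq, wp_store, wp_const,
    wp_skip, wp_block_nil, State.reg_setReg, State.mem_setReg, State.reg_setMem,
    Nat.reduceEqDiff, if_true, if_false, h10, h11, h12, hv]
  split_ifs with hlt
  · refine ⟨by norm_num, ⟨?_, ?_, ?_, ?_⟩, fun r hr => ?_⟩
    · simpa using h.table
    · simpa using h.size
    · simpa using h.points.update _ j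
    · have := h.relaxed.of_lt hi hj he (by lia)
      simpa [valuesAt_update] using this
    · split_ifs <;> first | rfl | lia
  · refine ⟨by norm_num, ⟨?_, ?_, ?_, ?_⟩, fun r hr => ?_⟩
    · simpa using h.table
    · simpa using h.size
    · simpa using h.points
    · have := h.relaxed.of_le hi (j := j) (w := w) (by lia)
      simpa using this
    · split_ifs <;> first | rfl | lia

/-- Replace the register `13` by the minimum of `0` and the registers `13` and `14`. -/
def minZero : Prog := .block [.sub 15 13 14, .ifPos 15 (.seq (.const 15 0) (.add 13 14 15)) .skip,
  .ifPos 13 (.const 13 0) .skip]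

theorem wp_minZero (s : State) : wp minZero s fun t s' => t ≤ 7 ∧ s'.mem = s.mem ∧
    (∀ r < 13, s'.reg r = s.reg r) ∧ s'.reg 13 = min (s.reg 13) (min (s.reg 14) 0) := by
  simp only [minZero, wp_block_cons, wp_add, wp_sub, wp_ifPos, wp_seq, wp_const,
    wp_skip, wp_block_nil, State.reg_setReg, State.mem_setReg, Nat.reduceEqDiff, if_true, if_false]
  split_ifs with c1 c2 c2 <;>
  refine ⟨by norm_num, trivial, fun r hr => ?_, by lia⟩ <;>
  split_ifs <;> first | rfl | lia

/-- The differences of the coordinates of the entries at the addresses in the registers `7` and `8`, and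
their sum. -/
def loadDiff : Prog := .block [.load 13 8, .load 14 7, .sub 13 13 14,
  .const 30 1, .add 15 7 30, .load 16 15, .add 15 8 30, .load 14 15, .sub 14 14 16,
  .add 12 13 14]

theorem wp_loadDiff (s : State) : wp loadDiff s fun t s' => t ≤ 11 ∧ s'.mem = s.mem ∧
    (∀ r < 12, s'.reg r = s.reg r) ∧ s'.reg 13 = s.mem (s.reg 8) - s.mem (s.reg 7) ∧
    s'.reg 14 = s.mem (s.reg 8 + 1) - s.mem (s.reg 7 + 1) ∧
    s'.reg 12 = s'.reg 13 + s'.reg 14 := by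
  simp only [loadDiff, wp_block_cons, wp_add, wp_sub, wp_load, wp_const,
    wp_block_nil, State.reg_setReg, State.mem_setReg, Nat.reduceEqDiff, if_true, if_false]
  refine ⟨by norm_num, trivial, fun r hr => ?_, trivial, trivial, trivial⟩
  split_ifs <;> first | rfl | lia

/-- Relax the edge between the entries at the addresses in the registers `7` and `8`, weighted by
their distance. -/
def relaxPair : Prog := .block [loadDiff, minZero, .sub 12 12 13, .sub 12 12 13, .sub 12 12 13,
  .const 30 2, .add 10 7 30, .add 11 8 30, relaxEdge]

theorem wp_relaxPair {T : ℤ} {n : ℕ} {p : ℕ → Vertex} {f₀ : ℕ → ℤ} {P : Set (ℕ × ℕ × ℤ)}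
    {s : State} (h : RoundState T n p f₀ P s) {i j : ℕ} (hi : i < 4 * n) (hj : j < 4 * n)
    (h7 : s.reg 7 = T + 3 * i) (h8 : s.reg 8 = T + 3 * j) :
    wp relaxPair s fun t s' => t ≤ 40 ∧
      RoundState T n p f₀ (insert (i, j, gridDist (p i) (p j)) P) s' ∧
      ∀ r < 9, s'.reg r = s.reg r := by
  have hpi := h.points i hi
  have hpj := h.points j hj
  rw [relaxPair, wp_block_cons]
  refine (wp_loadDiff s).mono ?_
  rintro t₁ s₁ ⟨ht₁, hm₁, hr₁, h13, h14, h12⟩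
  rw [h7, h8, hpi.1, hpj.1] at h13
  rw [h7, h8, hpi.2, hpj.2] at h14
  rw [wp_block_cons]
  refine (wp_minZero s₁).mono ?_
  rintro t₂ s₂ ⟨ht₂, hm₂, hr₂, h13'⟩
  have hr : ∀ r < 12, s₂.reg r = s.reg r := fun r hr => (hr₂ r (by lia)).trans (hr₁ r hr)
  have h12' := hr₂ 12 (by lia)
  rw [h13, h14] at h13' h12
  rw [h12] at h12'
  simp only [wp_block_cons, wp_add, wp_sub, wp_const, wp_block_nil, State.reg_setReg,
    Nat.reduceEqDiff, if_true, if_false, hr 7 (by lia), hr 8 (by lia), h7, h8, h12', h13']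
  refine wp.mono (wp_relaxEdge (h.congr ?_ ?_ ?_ ?_ subset_rfl) hi hj
    (.inl ⟨i, j, hi, hj, rfl⟩) ?_ ?_ ?_) ?_
  · simpa using hr 1 (by lia)
  · simpa using hr 2 (by lia)
  · simpa using hr 9 (by lia)
  · exact hm₂.trans hm₁
  · simp
  · simp
  -- Subtracting the minimum three times from the sum of the differences gives `gridDist`.
  · simp only [State.reg_setReg, Nat.reduceEqDiff, if_true, if_false]
    unfold gridDist
    ring
  · rintro t s' ⟨ht, hs, hr'⟩
    refine ⟨by lia, hs, fun r hr9 => ?_⟩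
    rw [hr' r hr9, ← hr r (by lia)]
    have : r < 10 := by lia
    simp only [State.reg_setReg_of_lt this, Nat.reduceLeDiff]

/-- Copy a register. -/
def move (r a : ℕ) : Prog := .block [.const 30 0, .add r a 30]

/-- Add a constant to a register. -/
def addConst (r : ℕ) (c : ℤ) : Prog := .block [.const 30 c, .add r r 30]

theorem wp_move {r a : ℕ} (ha : a ≠ 30) {s : State} {Q : ℕ → State → Prop} :
    wp (move r a) s Q ↔ Q 3 ((s.setReg 30 0).setReg r (s.reg a)) := by
  simp [move, ha]

theorem wp_addConst {r : ℕ} (hr : r ≠ 30) {c : ℤ} {s : State} {Q : ℕ → State → Prop} :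
    wp (addConst r c) s Q ↔ Q 3 ((s.setReg 30 c).setReg r (s.reg r + c)) := by
  simp [addConst, hr]

/-- Relax the edges from the entry at the address in register `7` to all entries. -/
def relaxRow : Prog := .block [move 8 1, move 6 2,
  .whilePos 6 (.block [relaxPair, addConst 8 3, addConst 6 (-1)])]

theorem wp_relaxRow {T : ℤ} {n : ℕ} {p : ℕ → Vertex} {f₀ : ℕ → ℤ} {P : Set (ℕ × ℕ × ℤ)}
    {s : State} (h : RoundState T n p f₀ P s) {i : ℕ} (hi : i < 4 * n) (h7 : s.reg 7 = T + 3 * i) :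
    wp relaxRow s fun t s' => t ≤ 4 * n * 50 + 8 ∧
      RoundState T n p f₀ (P ∪ {a | ∃ j < 4 * n, a = (i, j, gridDist (p i) (p j))}) s' ∧
      (∀ r < 6, s'.reg r = s.reg r) ∧ s'.reg 7 = s.reg 7 := by
  simp only [relaxRow, wp_block_cons, wp_move (show 1 ≠ 30 by decide),
    wp_move (show 2 ≠ 30 by decide), wp_block_nil, State.reg_setReg, Nat.reduceEqDiff, if_false,
    h.table, h.size]
  refine wp.mono (wp_whilePos (fun k s' =>
    RoundState T n p f₀ (P ∪ {a | ∃ j < k, a = (i, j, gridDist (p i) (p j))}) s' ∧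
    (∀ r < 6, s'.reg r = s.reg r) ∧ s'.reg 7 = s.reg 7 ∧ s'.reg 8 = T + 3 * k ∧
    s'.reg 6 = 4 * n - k) (4 * n) 49 ?_ ?_ ?_) ?_
  · rintro k s' hk ⟨h', hr', h7', h8', h6'⟩
    refine ⟨by lia, ?_⟩
    rw [wp_block_cons]
    refine (wp_relaxPair h' hi hk (h7'.trans h7) h8').mono ?_
    rintro t s'' ⟨ht, hs'', hr''⟩
    simp only [wp_block_cons, wp_addConst (show 8 ≠ 30 by decide),
      wp_addConst (show 6 ≠ 30 by decide), wp_block_nil]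
    refine ⟨by lia, hs''.congr ?_ ?_ ?_ rfl ?_, fun r hr => ?_, ?_, ?_, ?_⟩
    · simp
    · simp
    · simp
    · rintro a (ha | ⟨j, hj, rfl⟩)
      · exact .inr (.inl ha)
      · rcases Nat.lt_succ_iff_lt_or_eq.1 hj with hj | rfl
        · exact .inr (.inr ⟨j, hj, rfl⟩)
        · exact .inl rfl
    · simp only [State.reg_setReg_of_lt hr, Nat.reduceLeDiff, le_refl]
      rw [hr'' r (by lia), hr' r hr]
    · simp [hr'', h7']
    · simp [hr'', h8']; ring
    · simp [hr'', h6']; ring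
  · rintro s' ⟨-, -, -, -, h6'⟩
    rw [h6']; simp
  · refine ⟨h.congr ?_ ?_ ?_ rfl ?_, fun r hr => ?_, ?_, ?_, ?_⟩
    · simp
    · simp
    · simp
    · simp
    · simp only [State.reg_setReg_of_lt hr, Nat.reduceLeDiff, le_refl]
    · simp
    · simp
    · simp
  · rintro t s' ⟨ht, hs', hr', h7', -, -⟩
    exact ⟨by lia, hs', hr', h7'⟩

/-- Relax the edges between all entries. -/
def relaxPairs : Prog := .block [move 7 1, move 5 2,
  .whilePos 5 (.block [relaxRow, addConst 7 3, addConst 5 (-1)])]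

theorem wp_relaxPairs {T : ℤ} {n : ℕ} {p : ℕ → Vertex} {f₀ : ℕ → ℤ}
    {s : State} (h : RoundState T n p f₀ ∅ s) :
    wp relaxPairs s fun t s' => t ≤ 4 * n * (4 * n * 50 + 18) + 8 ∧ RoundState T n p f₀
      {a | ∃ i j, i < 4 * n ∧ j < 4 * n ∧ a = (i, j, gridDist (p i) (p j))} s' ∧
      ∀ r < 5, s'.reg r = s.reg r := by
  simp only [relaxPairs, wp_block_cons, wp_move (show 1 ≠ 30 by decide),
    wp_move (show 2 ≠ 30 by decide), wp_block_nil, State.reg_setReg, Nat.reduceEqDiff, if_false,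
    h.table, h.size]
  refine wp.mono (wp_whilePos (fun k s' =>
    RoundState T n p f₀ {a | ∃ i j, i < k ∧ j < 4 * n ∧ a = (i, j, gridDist (p i) (p j))} s' ∧
    (∀ r < 5, s'.reg r = s.reg r) ∧ s'.reg 7 = T + 3 * k ∧
    s'.reg 5 = 4 * n - k) (4 * n) (4 * n * 50 + 17) ?_ ?_ ?_) ?_
  · rintro k s' hk ⟨h', hr', h7', h5'⟩
    refine ⟨by lia, ?_⟩
    rw [wp_block_cons]
    refine (wp_relaxRow h' hk h7').mono ?_
    rintro t s'' ⟨ht, hs'', hr'', h7''⟩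
    simp only [wp_block_cons, wp_addConst (show 7 ≠ 30 by decide),
      wp_addConst (show 5 ≠ 30 by decide), wp_block_nil]
    refine ⟨by lia, hs''.congr ?_ ?_ ?_ rfl ?_, fun r hr => ?_, ?_, ?_⟩
    · simp
    · simp
    · simp
    · rintro a ⟨i, j, hi, hj, rfl⟩
      rcases Nat.lt_succ_iff_lt_or_eq.1 hi with hi | rfl
      · exact .inl ⟨i, j, hi, hj, rfl⟩
      · exact .inr ⟨j, hj, rfl⟩
    · simp only [State.reg_setReg_of_lt hr, Nat.reduceLeDiff, le_refl]
      rw [hr'' r (by lia), hr' r hr]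
    · simp [h7'', h7']; ring
    · simp [hr'', h5']; ring
  · rintro s' ⟨-, -, -, h5'⟩
    rw [h5']; simp
  · refine ⟨h.congr ?_ ?_ ?_ rfl ?_, fun r hr => ?_, ?_, ?_⟩
    · simp
    · simp
    · simp
    · rintro a ⟨i, j, hi, -⟩
      exact absurd hi (Nat.not_lt_zero i)
    · simp only [State.reg_setReg_of_lt hr, Nat.reduceLeDiff, le_refl]
    · simp
    · simp
  · rintro t s' ⟨ht, hs', hr', -, -⟩
    exact ⟨by lia, hs', hr'⟩

/-- Relax the edge of weight `c` between the entries whose values are stored at the distances `a` and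
`b` from the address in register `7`. -/
def relaxAt (a b c : ℤ) : Prog := .block [move 10 7, addConst 10 a, move 11 7, addConst 11 b,
  .const 12 c, relaxEdge]

theorem wp_relaxAt {T : ℤ} {n : ℕ} {p : ℕ → Vertex} {f₀ : ℕ → ℤ} {P : Set (ℕ × ℕ × ℤ)}
    {s : State} (h : RoundState T n p f₀ P s) {a b c : ℤ} {i j : ℕ} (hi : i < 4 * n)
    (hj : j < 4 * n) (he : (i, j, c) ∈ (entryGraph p n).edges)
    (ha : s.reg 7 + a = T + 3 * i + 2) (hb : s.reg 7 + b = T + 3 * j + 2) :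
    wp (relaxAt a b c) s fun t s' => t ≤ 24 ∧ RoundState T n p f₀ (insert (i, j, c) P) s' ∧
      ∀ r < 9, s'.reg r = s.reg r := by
  simp only [relaxAt, wp_block_cons, wp_move (show 7 ≠ 30 by decide), wp_const,
    wp_addConst (show 10 ≠ 30 by decide), wp_addConst (show 11 ≠ 30 by decide), wp_block_nil]
  refine wp.mono (wp_relaxEdge (h.congr ?_ ?_ ?_ ?_ subset_rfl) hi hj he ?_ ?_ ?_) ?_
  · simp
  · simp
  · simp
  · simp
  · simpa using ha
  · simpa using hb
  · simp
  · rintro t s' ⟨ht, hs', hr'⟩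
    refine ⟨by lia, hs', fun r hr => ?_⟩
    rw [hr' r hr]
    simp only [State.reg_setReg_of_lt hr, Nat.reduceLeDiff]

/-- Relax the edges of the negative graph. -/
def relaxBlocks : Prog := .block [move 7 1, move 5 2,
  .whilePos 5 (.block [relaxAt 5 2 (-1), relaxAt 8 11 0, relaxAt 11 8 0, addConst 7 12,
    addConst 5 (-4)])]

theorem wp_relaxBlocks {T : ℤ} {n : ℕ} {p : ℕ → Vertex} {f₀ : ℕ → ℤ} {P : Set (ℕ × ℕ × ℤ)}
    {s : State} (h : RoundState T n p f₀ P s) :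
    wp relaxBlocks s fun t s' => t ≤ n * 90 + 8 ∧ RoundState T n p f₀
      (P ∪ {a | ∃ b < n, a = (4 * b + 1, 4 * b, -1) ∨ a = (4 * b + 2, 4 * b + 3, 0) ∨
      a = (4 * b + 3, 4 * b + 2, 0)}) s' ∧ ∀ r < 5, s'.reg r = s.reg r := by
  simp only [relaxBlocks, wp_block_cons, wp_move (show 1 ≠ 30 by decide),
    wp_move (show 2 ≠ 30 by decide), wp_block_nil, State.reg_setReg, Nat.reduceEqDiff, if_false,
    h.table, h.size]
  refine wp.mono (wp_whilePos (fun k s' => RoundState T n p f₀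
      (P ∪ {a | ∃ b < k, a = (4 * b + 1, 4 * b, -1) ∨ a = (4 * b + 2, 4 * b + 3, 0) ∨
      a = (4 * b + 3, 4 * b + 2, 0)}) s' ∧
    (∀ r < 5, s'.reg r = s.reg r) ∧ s'.reg 7 = T + 12 * k ∧
    s'.reg 5 = 4 * n - 4 * k) n 89 ?_ ?_ ?_) ?_
  · rintro k s' hk ⟨h', hr', h7', h5'⟩
    refine ⟨by lia, ?_⟩
    rw [wp_block_cons]
    -- A block takes twelve cells and its entries have their values at offsets `2`, `5`, `8` and
    -- `11`.
    refine (wp_relaxAt h' (i := 4 * k + 1) (j := 4 * k) (by lia) (by lia)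
      (.inr ⟨k, hk, .inl rfl⟩) (by lia) (by lia)).mono ?_
    rintro t₁ s₁ ⟨ht₁, h₁, hr₁⟩
    have h7₁ := (hr₁ 7 (by lia)).trans h7'
    rw [wp_block_cons]
    refine (wp_relaxAt h₁ (i := 4 * k + 2) (j := 4 * k + 3) (by lia) (by lia)
      (.inr ⟨k, hk, .inr (.inl rfl)⟩) (by lia) (by lia)).mono ?_
    rintro t₂ s₂ ⟨ht₂, h₂, hr₂⟩
    have h7₂ := (hr₂ 7 (by lia)).trans h7₁
    rw [wp_block_cons]
    refine (wp_relaxAt h₂ (i := 4 * k + 3) (j := 4 * k + 2) (by lia) (by lia)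
      (.inr ⟨k, hk, .inr (.inr rfl)⟩) (by lia) (by lia)).mono ?_
    rintro t₃ s₃ ⟨ht₃, h₃, hr₃⟩
    have h7₃ := (hr₃ 7 (by lia)).trans h7₂
    have hr₄ : ∀ r < 6, s₃.reg r = s'.reg r := fun r hr => by
      rw [hr₃ r (by lia), hr₂ r (by lia), hr₁ r (by lia)]
    simp only [wp_block_cons, wp_addConst (show 7 ≠ 30 by decide),
      wp_addConst (show 5 ≠ 30 by decide), wp_block_nil]
    refine ⟨by lia, h₃.congr ?_ ?_ ?_ rfl ?_, fun r hr => ?_, ?_, ?_⟩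
    · simp
    · simp
    · simp
    · rintro a (ha | ⟨b, hb, hb'⟩)
      · exact .inr (.inr (.inr (.inl ha)))
      · rcases Nat.lt_succ_iff_lt_or_eq.1 hb with hb | rfl
        · exact .inr (.inr (.inr (.inr ⟨b, hb, hb'⟩)))
        · rcases hb' with rfl | rfl | rfl
          · exact .inr (.inr (.inl rfl))
          · exact .inr (.inl rfl)
          · exact .inl rfl
    · simp only [State.reg_setReg_of_lt hr, Nat.reduceLeDiff, le_refl]
      rw [hr₄ r (by lia), hr' r hr]
    · simp [h7₃]; ring
    · simp [hr₄, h5']; ring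
  · rintro s' ⟨-, -, -, h5'⟩
    rw [h5']; simp
  · refine ⟨h.congr ?_ ?_ ?_ rfl ?_, fun r hr => ?_, ?_, ?_⟩
    · simp
    · simp
    · simp
    · simp
    · simp only [State.reg_setReg_of_lt hr, Nat.reduceLeDiff, le_refl]
    · simp
    · simp
  · rintro t s' ⟨ht, hs', hr', -, -⟩
    exact ⟨by lia, hs', hr'⟩

/-- One round of relaxation of all edges. -/
def relaxRound : Prog := .block [.const 9 0, relaxPairs, relaxBlocks]

theorem wp_relaxRound {T : ℤ} {n : ℕ} {p : ℕ → Vertex} {s : State} (h1 : s.reg 1 = T)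
    (h2 : s.reg 2 = 4 * n) (hp : PointsAt s.mem T (4 * n) p) :
    wp relaxRound s fun t s' => t ≤ 1000 * (n + 1) ^ 2 ∧
      RoundState T n p (valuesAt s.mem T) (entryGraph p n).edges s' ∧
      ∀ r < 5, s'.reg r = s.reg r := by
  simp only [relaxRound, wp_block_cons, wp_const, wp_block_nil]
  refine wp.mono (wp_relaxPairs (n := n) (T := T) (p := p) (f₀ := valuesAt s.mem T)
    ⟨by simpa using h1, by simpa using h2, hp, fun _ _ => le_rfl, fun _ _ h => h,
      fun _ _ _ h => absurd h (Set.notMem_empty _), .inl ⟨by simp, fun _ _ => rfl⟩⟩) ?_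
  rintro t₁ s₁ ⟨ht₁, h₁, hr₁⟩
  refine (wp_relaxBlocks h₁).mono ?_
  rintro t₂ s₂ ⟨ht₂, h₂, hr₂⟩
  refine ⟨by nlinarith, h₂, fun r hr => ?_⟩
  rw [hr₂ r hr, hr₁ r hr]
  simp only [State.reg_setReg_of_lt hr, Nat.reduceLeDiff]

theorem entryGraph_closed (p : ℕ → Vertex) (n : ℕ) : (entryGraph p n).Closed := by
  rintro u v w (⟨i, j, hi, hj, h⟩ | ⟨b, hb, h | h | h⟩) <;>
  obtain ⟨rfl, rfl, rfl⟩ := by simpa using h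
  · exact ⟨hi, hj⟩
  all_goals
    simp only [entryGraph, Set.mem_ofPred_eq]
    lia

theorem RoundState.round {T : ℤ} {n : ℕ} {p : ℕ → Vertex} {f₀ : ℕ → ℤ} {s : State}
    (h : RoundState T n p f₀ (entryGraph p n).edges s) :
    (entryGraph p n).Round f₀ (valuesAt s.mem T) where
  le := h.relaxed.le
  lower := h.relaxed.lower
  relaxed := h.relaxed.relaxed

/-- All rounds of relaxation, and one more; register `0` records whether the last one changed
nothing. -/
def relaxRounds : Prog := .block [move 3 2, addConst 3 1,
  .whilePos 3 (.block [relaxRound, addConst 3 (-1)]), .const 30 1, .sub 0 30 9]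

theorem entryGraph_ncard (p : ℕ → Vertex) (n : ℕ) : (entryGraph p n).verts.ncard = 4 * n := by
  have : (entryGraph p n).verts = (Finset.range (4 * n) : Set ℕ) := by
    ext; simp [entryGraph]
  rw [this, Set.ncard_coe_finset, Finset.card_range]

theorem entryGraph_finite (p : ℕ → Vertex) (n : ℕ) : (entryGraph p n).verts.Finite :=
  Set.finite_lt_nat _

/-- There are `4 * n` entries, so in the feasible case `4 * n` rounds reach the greatest solution
and the additional round cannot change it. Conversely, a round without change exhibits its starting
values as a solution. -/
theorem wp_relaxRounds {T : ℤ} {n : ℕ} {p : ℕ → Vertex} {s : State} (h1 : s.reg 1 = T)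
    (h2 : s.reg 2 = 4 * n) (hp : PointsAt s.mem T (4 * n) p)
    (h0 : ∀ k < 4 * n, valuesAt s.mem T k = 0) :
    wp relaxRounds s fun t s' => t ≤ 5000 * (n + 1) ^ 3 ∧ s'.reg 1 = T ∧ s'.reg 2 = 4 * n ∧
      PointsAt s'.mem T (4 * n) p ∧
      ((entryGraph p n).Feasible → s'.reg 0 = 1 ∧ (entryGraph p n).IsMaxSol (valuesAt s'.mem T)) ∧
      (¬ (entryGraph p n).Feasible → s'.reg 0 = 0) := by
  simp only [relaxRounds, wp_block_cons, wp_move (show 2 ≠ 30 by decide), wp_const,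
    wp_sub, wp_addConst (show 3 ≠ 30 by decide), wp_block_nil]
  -- The last conjunct retains the values `f₀` before the final round, to which the change flag
  -- refers.
  refine wp.mono (wp_whilePos (fun k s' => s'.reg 1 = T ∧ s'.reg 2 = 4 * n ∧
    s'.reg 3 = 4 * n + 1 - k ∧ PointsAt s'.mem T (4 * n) p ∧
    (entryGraph p n).Rounds k (valuesAt s'.mem T) ∧
    (k = 4 * n + 1 → ∃ f₀, (entryGraph p n).Rounds (4 * n) f₀ ∧
      RoundState T n p f₀ (entryGraph p n).edges s')) (4 * n + 1) (1000 * (n + 1) ^ 2 + 4)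
      ?_ ?_ ?_) ?_
  · rintro k s' hk ⟨h1', h2', h3', hp', hR, -⟩
    refine ⟨by lia, ?_⟩
    rw [wp_block_cons]
    refine (wp_relaxRound h1' h2' hp').mono ?_
    rintro t s'' ⟨ht, hs'', hr⟩
    simp only [wp_block_cons, wp_addConst (show 3 ≠ 30 by decide), wp_block_nil]
    refine ⟨by lia, ?_, ?_, ?_, hs''.points, hR.succ hs''.round, fun hk' => ⟨_, ?_,
      hs''.congr ?_ ?_ ?_ rfl subset_rfl⟩⟩
    · simp [hr, h1']
    · simp [hr, h2']
    · simp [hr, h3']; ring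
    · obtain rfl : k = 4 * n := by lia
      exact hR
    · simp
    · simp
    · simp
  · rintro s' ⟨-, -, h3', -⟩
    rw [h3']; simp
  · refine ⟨by simpa using h1, by simpa using h2, by simpa using h2, hp, .zero fun v hv => h0 v hv,
      fun h => by lia⟩
  · rintro t s' ⟨ht, h1', h2', -, hp', hR, hlast⟩
    obtain ⟨f₀, hR₀, hS⟩ := hlast rfl
    refine ⟨?_, by simpa using h1', by simpa using h2', hp', fun hF => ⟨?_, ?_⟩, fun hF => ?_⟩
    · have : 1 ≤ (n + 1) ^ 3 := Nat.one_le_pow _ _ (by lia)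
      have e : 4 * (n + 1) * (1000 * (n + 1) ^ 2 + 5) =
        4000 * (n + 1) ^ 3 + 20 * (n + 1) := by ring
      have e2 : n + 1 ≤ (n + 1) ^ 3 := Nat.le_self_pow (by lia) _
      have e3 : (4 * n + 1) * (1000 * (n + 1) ^ 2 + 4 + 1) ≤
        4 * (n + 1) * (1000 * (n + 1) ^ 2 + 5) := Nat.mul_le_mul (by lia) (by lia)
      lia
    · have hmax := hR₀.isMaxSol hF (entryGraph_closed p n) (entryGraph_finite p n)
        (entryGraph_ncard p n).le
      rcases hS.relaxed.flag with ⟨h9, -⟩ | ⟨-, v, hv, hlt⟩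
      · simp [h9]
      · exact absurd hlt (hS.relaxed.lower _ hmax.solves (fun _ _ => le_rfl) v hv).not_gt
    · exact hR.isMaxSol hF (entryGraph_closed p n) (entryGraph_finite p n)
        ((entryGraph_ncard p n).le.trans (Nat.le_succ _))
    · rcases hS.relaxed.flag with ⟨-, heq⟩ | ⟨h9, -⟩
      · refine absurd ⟨f₀, fun u v w hw => ?_⟩ hF
        have e1 := hS.relaxed.relaxed u v w hw
        have e2 := heq v (entryGraph_closed p n u v w hw).2
        lia
      · simp [h9]

/-! ### The table of entries -/

/-- The entries of the block of an edge `e`; `b` tells whether its lateral edges are present. -/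
def corner (b : Bool) (e : Edge) : ℕ → Vertex
  | 0 => e.src
  | 1 => e.tgt
  | 2 => if b then e.sideA else e.src
  | _ => if b then e.sideB else e.src

/-- The edge of the block with number `b`. -/
def blockEdge (l₁ l₂ : List Edge) (b : ℕ) : Edge := (l₁ ++ l₂).getD b default

/-- The point of the entry with number `k`. -/
def point (l₁ l₂ : List Edge) (k : ℕ) : Vertex :=
  corner (decide (l₁.length ≤ k / 4)) (blockEdge l₁ l₂ (k / 4)) (k % 4)

theorem point_mul_add (l₁ l₂ : List Edge) (b : ℕ) {r : ℕ} (hr : r < 4) :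
    point l₁ l₂ (4 * b + r) = corner (decide (l₁.length ≤ b)) (blockEdge l₁ l₂ b) r := by
  have h1 : (4 * b + r) / 4 = b := by lia
  have h2 : (4 * b + r) % 4 = r := by lia
  rw [point, h1, h2]

theorem blockEdge_cases {l₁ l₂ : List Edge} {b : ℕ} (hb : b < l₁.length + l₂.length) :
    (b < l₁.length ∧ blockEdge l₁ l₂ b ∈ l₁) ∨ (l₁.length ≤ b ∧ blockEdge l₁ l₂ b ∈ l₂) := by
  rcases lt_or_ge b l₁.length with h | h
  · refine .inl ⟨h, ?_⟩
    rw [blockEdge, List.getD_append _ _ _ _ h, List.getD_eq_getElem _ _ h]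
    exact List.getElem_mem h
  · refine .inr ⟨h, ?_⟩
    rw [blockEdge, List.getD_append_right _ _ _ _ h,
      List.getD_eq_getElem _ _ (show b - l₁.length < l₂.length by lia)]
    exact List.getElem_mem _

theorem exists_blockEdge_left {l₁ : List Edge} (l₂ : List Edge) {e : Edge} (he : e ∈ l₁) :
    ∃ b < l₁.length, blockEdge l₁ l₂ b = e := by
  obtain ⟨b, hb, rfl⟩ := List.getElem_of_mem he
  exact ⟨b, hb, by rw [blockEdge, List.getD_append _ _ _ _ hb, List.getD_eq_getElem _ _ hb]⟩

theorem exists_blockEdge_right (l₁ : List Edge) {l₂ : List Edge} {e : Edge} (he : e ∈ l₂) :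
    ∃ b < l₁.length + l₂.length, l₁.length ≤ b ∧ blockEdge l₁ l₂ b = e := by
  obtain ⟨b, hb, rfl⟩ := List.getElem_of_mem he
  refine ⟨l₁.length + b, by lia, by lia, ?_⟩
  rw [blockEdge, List.getD_append_right _ _ _ _ (by lia), Nat.add_sub_cancel_left,
    List.getD_eq_getElem _ _ hb]

section transfer

variable {l₁ l₂ : List Edge}

theorem blockEdge_mem {b : ℕ} (hb : b < l₁.length + l₂.length) :
    blockEdge l₁ l₂ b ∈ l₁.toFinset ∪ l₂.toFinset := by
  rcases blockEdge_cases hb with h | h <;> simp [h.2]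

theorem point_mem {k : ℕ} (hk : k < 4 * (l₁.length + l₂.length)) :
    point l₁ l₂ k ∈ (posNegGraph l₁.toFinset l₂.toFinset).verts := by
  have hb : k / 4 < l₁.length + l₂.length := by lia
  have hm := blockEdge_mem hb
  rw [mem_posNegGraph_verts, point]
  have hr : k % 4 = 0 ∨ k % 4 = 1 ∨ k % 4 = 2 ∨ k % 4 = 3 := by lia
  rcases blockEdge_cases hb with ⟨h, hl⟩ | ⟨h, hl⟩
  · rw [decide_eq_false h.not_ge]
    rcases hr with hr | hr | hr | hr <;> rw [hr] <;> refine .inl ⟨_, hm, ?_⟩ <;> simp [corner]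
  · rw [decide_eq_true h]
    have hm' := List.mem_toFinset.2 hl
    rcases hr with hr | hr | hr | hr <;> rw [hr]
    · exact .inl ⟨_, hm, .inl rfl⟩
    · exact .inl ⟨_, hm, .inr rfl⟩
    · exact .inr ⟨_, hm', .inl rfl⟩
    · exact .inr ⟨_, hm', .inr rfl⟩

theorem exists_block_ends {e : Edge} (he : e ∈ l₁.toFinset ∪ l₂.toFinset) :
    ∃ b < l₁.length + l₂.length, point l₁ l₂ (4 * b) = e.src ∧ point l₁ l₂ (4 * b + 1) = e.tgt := by
  have : ∃ b < l₁.length + l₂.length, blockEdge l₁ l₂ b = e := by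
    rcases Finset.mem_union.1 he with he | he <;> rw [List.mem_toFinset] at he
    · obtain ⟨b, hb, h⟩ := exists_blockEdge_left l₂ he
      exact ⟨b, by lia, h⟩
    · obtain ⟨b, hb, -, h⟩ := exists_blockEdge_right l₁ he
      exact ⟨b, hb, h⟩
  obtain ⟨b, hb, rfl⟩ := this
  exact ⟨b, hb, point_mul_add l₁ l₂ b (r := 0) (by lia), point_mul_add l₁ l₂ b (r := 1) (by lia)⟩

theorem exists_block_sides {e : Edge} (he : e ∈ l₂.toFinset) :
    ∃ b < l₁.length + l₂.length, point l₁ l₂ (4 * b + 2) = e.sideA ∧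
      point l₁ l₂ (4 * b + 3) = e.sideB := by
  obtain ⟨b, hb, h, rfl⟩ := exists_blockEdge_right l₁ (List.mem_toFinset.1 he)
  refine ⟨b, hb, ?_, ?_⟩ <;> rw [point_mul_add l₁ l₂ b (by lia), decide_eq_true h] <;> rfl

theorem exists_point {v : Vertex} (hv : v ∈ (posNegGraph l₁.toFinset l₂.toFinset).verts) :
    ∃ k < 4 * (l₁.length + l₂.length), point l₁ l₂ k = v := by
  rcases mem_posNegGraph_verts.1 hv with ⟨e, he, h⟩ | ⟨e, he, h⟩
  · obtain ⟨b, hb, h1, h2⟩ := exists_block_ends he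
    rcases h with rfl | rfl
    · exact ⟨_, by lia, h1⟩
    · exact ⟨_, by lia, h2⟩
  · obtain ⟨b, hb, h1, h2⟩ := exists_block_sides (l₁ := l₁) he
    rcases h with rfl | rfl
    · exact ⟨_, by lia, h1⟩
    · exact ⟨_, by lia, h2⟩

theorem solves_comp_point {h : Vertex → ℤ}
    (hs : (posNegGraph l₁.toFinset l₂.toFinset).Solves h) :
    (entryGraph (point l₁ l₂) (l₁.length + l₂.length)).Solves fun k => h (point l₁ l₂ k) := by
  obtain ⟨h1, h2, h3⟩ := posNegGraph_solves_iff.1 hs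
  rintro u v w (⟨i, j, hi, hj, he⟩ | ⟨b, hb, he⟩)
  · obtain ⟨rfl, rfl, rfl⟩ := by simpa using he
    exact h1 _ (point_mem hi) _ (point_mem hj)
  · have e0 := point_mul_add l₁ l₂ b (r := 0) (by lia)
    have e1 := point_mul_add l₁ l₂ b (r := 1) (by lia)
    have e2 := point_mul_add l₁ l₂ b (r := 2) (by lia)
    have e3 := point_mul_add l₁ l₂ b (r := 3) (by lia)
    have h4 := h2 _ (blockEdge_mem hb)
    -- In a block of `l₁` the last two entries are padding equal to the starting point of the edge,
    -- so its lateral constraints hold trivially.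
    have h5 : h (point l₁ l₂ (4 * b + 2)) = h (point l₁ l₂ (4 * b + 3)) := by
      rw [e2, e3]
      rcases blockEdge_cases hb with ⟨h, hl⟩ | ⟨h, hl⟩
      · rw [decide_eq_false h.not_ge]; rfl
      · rw [decide_eq_true h]
        exact h3 _ (List.mem_toFinset.2 hl)
    rcases he with he | he | he <;> obtain ⟨rfl, rfl, rfl⟩ := by simpa using he
    · simp only
      rw [add_zero] at e0
      rw [e0, e1]
      exact h4
    · simp only; lia
    · simp only; lia

/-- Entries holding the same point are joined both ways by edges of weight zero, so `f` is constant
on them and descends to vertices. -/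
theorem exists_solves_of_entryGraph {f : ℕ → ℤ}
    (hf : (entryGraph (point l₁ l₂) (l₁.length + l₂.length)).Solves f) :
    ∃ h, (posNegGraph l₁.toFinset l₂.toFinset).Solves h ∧
      ∀ k < 4 * (l₁.length + l₂.length), h (point l₁ l₂ k) = f k := by
  classical
  have heq : ∀ k k', k < 4 * (l₁.length + l₂.length) → k' < 4 * (l₁.length + l₂.length) →
      point l₁ l₂ k = point l₁ l₂ k' → f k' ≤ f k := fun k k' hk hk' h => by
    have := hf k k' _ (.inl ⟨k, k', hk, hk', rfl⟩)
    rw [h, gridDist_self] at this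
    lia
  let h : Vertex → ℤ := fun v =>
    if hv : ∃ k < 4 * (l₁.length + l₂.length), point l₁ l₂ k = v then f hv.choose else 0
  have hh : ∀ k < 4 * (l₁.length + l₂.length), h (point l₁ l₂ k) = f k := fun k hk => by
    have hv : ∃ k' < 4 * (l₁.length + l₂.length), point l₁ l₂ k' = point l₁ l₂ k := ⟨k, hk, rfl⟩
    have hc := hv.choose_spec
    simp only [h, dif_pos hv]
    exact le_antisymm (heq _ _ hk hc.1 hc.2.symm) (heq _ _ hc.1 hk hc.2)
  refine ⟨h, posNegGraph_solves_iff.2 ⟨fun u hu v hv => ?_, fun e he => ?_, fun e he => ?_⟩, hh⟩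
  · obtain ⟨i, hi, rfl⟩ := exists_point hu
    obtain ⟨j, hj, rfl⟩ := exists_point hv
    rw [hh i hi, hh j hj]
    exact hf _ _ _ (.inl ⟨i, j, hi, hj, rfl⟩)
  · obtain ⟨b, hb, h1, h2⟩ := exists_block_ends he
    rw [← h1, ← h2, hh _ (by lia), hh _ (by lia)]
    exact hf _ _ _ (.inr ⟨b, hb, .inl rfl⟩)
  · obtain ⟨b, hb, h1, h2⟩ := exists_block_sides (l₁ := l₁) he
    rw [← h1, ← h2, hh _ (by lia), hh _ (by lia)]
    have e1 := hf _ _ _ (.inr ⟨b, hb, .inr (.inl rfl)⟩)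
    have e2 := hf _ _ _ (.inr ⟨b, hb, .inr (.inr rfl)⟩)
    lia

theorem entryGraph_feasible_iff :
    (entryGraph (point l₁ l₂) (l₁.length + l₂.length)).Feasible ↔
      (posNegGraph l₁.toFinset l₂.toFinset).Feasible :=
  ⟨fun ⟨_, hf⟩ => (exists_solves_of_entryGraph hf).imp fun _ h => h.1,
    fun ⟨_, hs⟩ => ⟨_, solves_comp_point hs⟩⟩

/-- Solutions and nonpositivity transfer in both directions between vertices and entries, so each
greatest solution dominates the other. -/
theorem bellmanFord_point (hF : (posNegGraph l₁.toFinset l₂.toFinset).Feasible) {f : ℕ → ℤ}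
    (hf : (entryGraph (point l₁ l₂) (l₁.length + l₂.length)).IsMaxSol f) {k : ℕ}
    (hk : k < 4 * (l₁.length + l₂.length)) :
    (posNegGraph l₁.toFinset l₂.toFinset).bellmanFord (point l₁ l₂ k) = f k := by
  have hB := WDigraph.isMaxSol_bellmanFord (posNegGraph_closed l₁.toFinset l₂.toFinset)
    (posNegGraph_verts_finite _ _) (posNegGraph_edges_finite _ _) hF
  refine le_antisymm (hf.max _ (solves_comp_point hB.solves)
    (fun j hj => hB.nonpos _ (point_mem hj)) k hk) ?_
  obtain ⟨h, hs, hh⟩ := exists_solves_of_entryGraph hf.solves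
  rw [← hh k hk]
  refine hB.max h hs (fun v hv => ?_) _ (point_mem hk)
  obtain ⟨j, hj, rfl⟩ := exists_point hv
  rw [hh j hj]
  exact hf.nonpos j hj

end transfer

/-! ### Building the table -/

/-- Set the registers `13` to `18`. -/
def setOffsets (a b c d e f : ℤ) : Prog := .block [.const 13 a, .const 14 b, .const 15 c, .const 16 d,
  .const 17 e, .const 18 f]

/-- Read an edge at the address in register `3`. -/
def loadEdge : Prog := .block [.load 10 3, addConst 3 1, .load 11 3, addConst 3 1, .load 12 3,
  addConst 3 1]

/-- The offsets of the further entries of the block of an edge of direction register `12`. -/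
def findOffsets : Prog := .ifPos 12 (.block [addConst 12 (-1),
    .ifPos 12 (setOffsets (-1) (-1) (-1) 0 0 (-1)) (setOffsets 0 1 1 1 (-1) 0)])
    (setOffsets 1 0 0 (-1) 1 1)

/-- Drop the lateral entries if register `0` is positive. -/
def dropSides : Prog :=
  .ifPos 0 (.block [.const 15 0, .const 16 0, .const 17 0, .const 18 0]) .skip

/-- Read an edge at the address in register `3` and compute the entries of its block. -/
def readEdge : Prog := .block [loadEdge, findOffsets, dropSides]

theorem wp_loadEdge {s : State} {e : Edge} (h0 : s.mem (s.reg 3) = e.1.1)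
    (h1 : s.mem (s.reg 3 + 1) = e.1.2) (h2 : s.mem (s.reg 3 + 2) = (e.2 : ℕ)) :
    wp loadEdge s fun t s' => t ≤ 20 ∧ s'.mem = s.mem ∧ (∀ r < 10, r ≠ 3 → s'.reg r = s.reg r) ∧
      s'.reg 3 = s.reg 3 + 3 ∧ s'.reg 10 = e.1.1 ∧ s'.reg 11 = e.1.2 ∧ s'.reg 12 = (e.2 : ℕ) := by
  have h3 : s.reg 3 + 1 + 1 = s.reg 3 + 2 := by ring
  have h4 : s.reg 3 + 2 + 1 = s.reg 3 + 3 := by ring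
  simp only [loadEdge, wp_block_cons, wp_load, wp_addConst (show 3 ≠ 30 by decide), wp_block_nil,
    State.reg_setReg, State.mem_setReg, Nat.reduceEqDiff, if_true, if_false, h0, h1, h2, h3, h4]
  refine ⟨by norm_num, trivial, fun r hr hr3 => ?_, trivial, trivial, trivial, trivial⟩
  split_ifs <;> first | rfl | lia

theorem wp_setOffsets {a b c d e f : ℤ} {s : State} : wp (setOffsets a b c d e f) s fun t s' =>
    t ≤ 7 ∧ s'.mem = s.mem ∧ (∀ r < 12, s'.reg r = s.reg r) ∧ s'.reg 13 = a ∧ s'.reg 14 = b ∧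
      s'.reg 15 = c ∧ s'.reg 16 = d ∧ s'.reg 17 = e ∧ s'.reg 18 = f := by
  simp only [setOffsets, wp_block_cons, wp_const, wp_block_nil,
    State.reg_setReg, State.mem_setReg, Nat.reduceEqDiff, if_true, if_false]
  refine ⟨by norm_num, trivial, fun r hr => ?_, by simp⟩
  simp only [if_neg (show r ≠ 13 by lia), if_neg (show r ≠ 14 by lia),
    if_neg (show r ≠ 15 by lia), if_neg (show r ≠ 16 by lia), if_neg (show r ≠ 17 by lia),
    if_neg (show r ≠ 18 by lia)]

/-- The constants are the coordinates of `dir i`, `-dir (i + 1)` and `-dir (i + 2)` in the three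
cases. -/
theorem wp_findOffsets {s : State} {e : Edge} (h : s.reg 12 = (e.2 : ℕ)) :
    wp findOffsets s fun t s' => t ≤ 20 ∧ s'.mem = s.mem ∧ (∀ r < 12, s'.reg r = s.reg r) ∧
      e.tgt = (e.1.1 + s'.reg 13, e.1.2 + s'.reg 14) ∧
      e.sideA = (e.1.1 + s'.reg 15, e.1.2 + s'.reg 16) ∧
      e.sideB = (e.1.1 + s'.reg 17, e.1.2 + s'.reg 18) := by
  obtain ⟨⟨x, y⟩, i⟩ := e
  simp only [findOffsets, wp_block_cons, wp_ifPos, wp_addConst (show 12 ≠ 30 by decide),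
    wp_block_nil, State.reg_setReg, h]
  rcases fin_three_cases i with rfl | rfl | rfl
  · refine wp.mono wp_setOffsets ?_
    rintro t s' ⟨ht, hm, hr, h13, h14, h15, h16, h17, h18⟩
    exact ⟨by lia, hm, hr, by simp [Edge.tgt, dir_zero, h13, h14],
      by simp [Edge.sideA, dir_one, h15, h16]; ring,
      by simp [Edge.sideB, dir_two, h17, h18]⟩
  · refine wp.mono wp_setOffsets ?_
    rintro t s' ⟨ht, hm, hr, h13, h14, h15, h16, h17, h18⟩
    exact ⟨by lia, hm, fun r hr' => by
        rw [hr r hr', State.reg_setReg_of_lt hr' le_rfl, State.reg_setReg_of_lt hr' (by decide)],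
      by simp [Edge.tgt, dir_one, h13, h14],
      by simp [Edge.sideA, fin_three_one_add_one, dir_two, h15, h16],
      by simp [Edge.sideB, fin_three_one_add_two, dir_zero, h17, h18]; ring⟩
  · refine wp.mono wp_setOffsets ?_
    rintro t s' ⟨ht, hm, hr, h13, h14, h15, h16, h17, h18⟩
    exact ⟨by lia, hm, fun r hr' => by
        rw [hr r hr', State.reg_setReg_of_lt hr' le_rfl, State.reg_setReg_of_lt hr' (by decide)],
      by simp [Edge.tgt, dir_two, h13, h14],
      by simp [Edge.sideA, fin_three_two_add_one, dir_zero, h15, h16]; ring,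
      by simp [Edge.sideB, fin_three_two_add_two, dir_one, h17, h18]; ring⟩

/-- Zero offsets turn the lateral entries into copies of the starting point. -/
theorem wp_dropSides (s : State) : wp dropSides s fun t s' => t ≤ 6 ∧ s'.mem = s.mem ∧
    (∀ r < 15, s'.reg r = s.reg r) ∧
      ∀ r, 15 ≤ r → r < 19 → s'.reg r = if s.reg 0 ≤ 0 then s.reg r else 0 := by
  rw [dropSides, wp_ifPos]
  split_ifs with h h'
  · lia
  · simp only [wp_block_cons, wp_const, wp_block_nil, State.reg_setReg, State.mem_setReg]
    refine ⟨by norm_num, trivial, fun r hr => ?_, fun r hr hr' => ?_⟩ <;>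
    split_ifs <;> first | rfl | lia
  · rw [wp_skip]
    exact ⟨by norm_num, rfl, fun _ _ => rfl, fun _ _ _ => rfl⟩
  · lia

theorem wp_readEdge {s : State} {e : Edge} (h0 : s.mem (s.reg 3) = e.1.1)
    (h1 : s.mem (s.reg 3 + 1) = e.1.2) (h2 : s.mem (s.reg 3 + 2) = (e.2 : ℕ)) :
    wp readEdge s fun t s' => t ≤ 60 ∧ s'.mem = s.mem ∧ (∀ r < 10, r ≠ 3 → s'.reg r = s.reg r) ∧
      s'.reg 3 = s.reg 3 + 3 ∧ e.src = (s'.reg 10, s'.reg 11) ∧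
      e.tgt = (s'.reg 10 + s'.reg 13, s'.reg 11 + s'.reg 14) ∧
      corner (decide (s.reg 0 ≤ 0)) e 2 = (s'.reg 10 + s'.reg 15, s'.reg 11 + s'.reg 16) ∧
      corner (decide (s.reg 0 ≤ 0)) e 3 = (s'.reg 10 + s'.reg 17, s'.reg 11 + s'.reg 18) := by
  rw [readEdge, wp_block_cons]
  refine (wp_loadEdge h0 h1 h2).mono ?_
  rintro t₁ s₁ ⟨ht₁, hm₁, hr₁, h3₁, h10, h11, h12⟩
  rw [wp_block_cons]
  refine (wp_findOffsets h12).mono ?_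
  rintro t₂ s₂ ⟨ht₂, hm₂, hr₂, hT, hA, hB⟩
  rw [wp_block_cons]
  refine (wp_dropSides s₂).mono ?_
  rintro t₃ s₃ ⟨ht₃, hm₃, hr₃, hS⟩
  rw [wp_block_nil]
  have hr : ∀ r < 12, s₃.reg r = s₁.reg r := fun r hr => by rw [hr₃ r (by lia), hr₂ r hr]
  have hs0 : s₂.reg 0 = s.reg 0 := by rw [hr₂ 0 (by lia), hr₁ 0 (by lia) (by lia)]
  rw [hr 10 (by lia), hr 11 (by lia), hr 3 (by lia), h10, h11, h3₁, hr₃ 13 (by lia),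
    hr₃ 14 (by lia), hS 15 (by lia) (by lia), hS 16 (by lia) (by lia), hS 17 (by lia) (by lia),
    hS 18 (by lia) (by lia), hs0]
  refine ⟨by lia, by rw [hm₃, hm₂, hm₁], fun r hr10 hr3 => ?_, rfl, rfl, hT, ?_, ?_⟩
  · rw [hr r (by lia), hr₁ r hr10 hr3]
  · by_cases h : s.reg 0 ≤ 0 <;> simp [h, corner, hA, Edge.src]
  · by_cases h : s.reg 0 ≤ 0 <;> simp [h, corner, hB, Edge.src]

/-- The memory holds an entry with value `0` at the address `a`. -/
def EntryAt (m : ℤ → ℤ) (a : ℤ) (v : Vertex) : Prop := m a = v.1 ∧ m (a + 1) = v.2 ∧ m (a + 2) = 0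

theorem EntryAt.congr {m m' : ℤ → ℤ} {a w : ℤ} {v : Vertex} (h : EntryAt m a v) (ha : a + 2 < w)
    (hm : ∀ c < w, m' c = m c) : EntryAt m' a v := by
  obtain ⟨h1, h2, h3⟩ := h
  refine ⟨?_, ?_, ?_⟩ <;> rw [hm _ (by lia)] <;> assumption

/-- Append an entry of the table at the address in register `4`. -/
def writeEntry (a b : ℕ) : Prog := .block [.add 20 10 a, .store 4 20, addConst 4 1, .add 20 11 b,
  .store 4 20, addConst 4 1, .const 20 0, .store 4 20, addConst 4 1]

/-- The bounds on `b` keep it apart from the pointer `4` and the scratch registers `20` and `30`,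
which are overwritten before `b` is read. -/
theorem wp_writeEntry {s : State} {a b : ℕ} (hb : 4 < b) (hb' : b < 20) :
    wp (writeEntry a b) s fun t s' => t ≤ 20 ∧
      (∀ r < 20, r ≠ 4 → s'.reg r = s.reg r) ∧ s'.reg 4 = s.reg 4 + 3 ∧
      (∀ c < s.reg 4, s'.mem c = s.mem c) ∧
      EntryAt s'.mem (s.reg 4) (s.reg 10 + s.reg a, s.reg 11 + s.reg b) := by
  have b4 : b ≠ 4 := by lia
  have b20 : b ≠ 20 := by lia
  have b30 : b ≠ 30 := by lia
  simp only [writeEntry, EntryAt, wp_block_cons, wp_const, wp_add, wp_store,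
    wp_addConst (show 4 ≠ 30 by decide), wp_block_nil,
    State.reg_setReg, State.mem_setReg, State.reg_setMem, State.mem_setMem, Nat.reduceEqDiff,
    if_true, if_false, b4, b20, b30]
  refine ⟨by norm_num, fun r hr hr4 => ?_, by ring, fun c hc => ?_, ?_, ?_, ?_⟩
  · rw [if_neg hr4]
    split_ifs <;> first | rfl | lia
  · rw [Function.update_of_ne (by lia), Function.update_of_ne (by lia),
      Function.update_of_ne (by lia)]
  · rw [Function.update_of_ne (by lia), Function.update_of_ne (by lia), Function.update_self]
  · rw [Function.update_of_ne (by lia), Function.update_self]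
  · rw [show s.reg 4 + 2 = s.reg 4 + 1 + 1 by ring, Function.update_self]

/-- Append a block of the table. -/
def writeBlock : Prog := .block [.const 19 0, writeEntry 19 19, writeEntry 13 14, writeEntry 15 16,
  writeEntry 17 18]

theorem wp_writeBlock (s : State) : wp writeBlock s fun t s' => t ≤ 90 ∧
      (∀ r < 19, r ≠ 4 → s'.reg r = s.reg r) ∧ s'.reg 4 = s.reg 4 + 12 ∧
      (∀ c < s.reg 4, s'.mem c = s.mem c) ∧
      EntryAt s'.mem (s.reg 4) (s.reg 10, s.reg 11) ∧
      EntryAt s'.mem (s.reg 4 + 3) (s.reg 10 + s.reg 13, s.reg 11 + s.reg 14) ∧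
      EntryAt s'.mem (s.reg 4 + 6) (s.reg 10 + s.reg 15, s.reg 11 + s.reg 16) ∧
      EntryAt s'.mem (s.reg 4 + 9) (s.reg 10 + s.reg 17, s.reg 11 + s.reg 18) := by
  rw [writeBlock, wp_block_cons, wp_const, wp_block_cons]
  refine (wp_writeEntry (by decide) (by decide)).mono ?_
  rintro t₁ s₁ ⟨ht₁, hr₁, h4₁, hm₁, e₁⟩
  simp only [State.reg_setReg, State.mem_setReg, Nat.reduceEqDiff, if_true, if_false, add_zero]
    at hr₁ h4₁ hm₁ e₁
  have hr₁' : ∀ r < 19, r ≠ 4 → s₁.reg r = s.reg r := fun r hr hr4 => by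
    rw [hr₁ r (by lia) hr4, if_neg (by lia)]
  rw [wp_block_cons]
  refine (wp_writeEntry (by decide) (by decide)).mono ?_
  rintro t₂ s₂ ⟨ht₂, hr₂, h4₂, hm₂, e₂⟩
  have hr₂' : ∀ r < 19, r ≠ 4 → s₂.reg r = s.reg r := fun r hr hr4 => by
    rw [hr₂ r (by lia) hr4, hr₁' r hr hr4]
  rw [wp_block_cons]
  refine (wp_writeEntry (by decide) (by decide)).mono ?_
  rintro t₃ s₃ ⟨ht₃, hr₃, h4₃, hm₃, e₃⟩
  have hr₃' : ∀ r < 19, r ≠ 4 → s₃.reg r = s.reg r := fun r hr hr4 => by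
    rw [hr₃ r (by lia) hr4, hr₂' r hr hr4]
  rw [wp_block_cons]
  refine (wp_writeEntry (by decide) (by decide)).mono ?_
  rintro t₄ s₄ ⟨ht₄, hr₄, h4₄, hm₄, e₄⟩
  rw [wp_block_nil]
  rw [hr₁' 10 (by decide) (by decide), hr₁' 11 (by decide) (by decide),
    hr₁' 13 (by decide) (by decide), hr₁' 14 (by decide) (by decide)] at e₂
  rw [hr₂' 10 (by decide) (by decide), hr₂' 11 (by decide) (by decide),
    hr₂' 15 (by decide) (by decide), hr₂' 16 (by decide) (by decide)] at e₃
  rw [hr₃' 10 (by decide) (by decide), hr₃' 11 (by decide) (by decide),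
    hr₃' 17 (by decide) (by decide), hr₃' 18 (by decide) (by decide)] at e₄
  have w₂ : s₂.reg 4 = s.reg 4 + 6 := by lia
  have w₃ : s₃.reg 4 = s.reg 4 + 9 := by lia
  rw [h4₁] at e₂
  rw [w₂] at e₃
  rw [w₃] at e₄
  refine ⟨by lia, fun r hr hr4 => ?_, by lia, fun c hc => ?_, ?_, ?_, ?_, e₄⟩
  · rw [hr₄ r (by lia) hr4, hr₃' r hr hr4]
  · rw [hm₄ c (by lia), hm₃ c (by lia), hm₂ c (by lia), hm₁ c (by lia)]
  · exact ((e₁.congr (by lia) hm₂).congr (by lia) hm₃).congr (by lia) hm₄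
  · exact (e₂.congr (by lia) hm₃).congr (by lia) hm₄
  · exact e₃.congr (by lia) hm₄

/-- The memory holds the list of edges `e 0, …, e (n - 1)` from address `0` on. -/
def EdgesAt (m : ℤ → ℤ) (n : ℕ) (e : ℕ → Edge) : Prop :=
  ∀ k < n, m (3 * k) = (e k).1.1 ∧ m (3 * k + 1) = (e k).1.2 ∧ m (3 * k + 2) = ((e k).2 : ℕ)

/-- Build the table. -/
def buildTable : Prog := .block [.add 5 0 1, .add 1 5 5, .add 1 1 5, .add 2 5 5, .add 2 2 2,
  .const 3 0, move 4 1,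
  .whilePos 5 (.block [readEdge, writeBlock, addConst 0 (-1), addConst 5 (-1)])]

/-- The table starts right behind the input, at `3 * (n₁ + n₂)`, and writing only moves upwards, so
neither unread edges nor earlier blocks are overwritten. -/
theorem wp_buildTable {s : State} {n₁ n₂ : ℕ} {e : ℕ → Edge} (h0 : s.reg 0 = n₁)
    (h1 : s.reg 1 = n₂) (he : EdgesAt s.mem (n₁ + n₂) e) :
    wp buildTable s fun t s' => t ≤ (n₁ + n₂) * 160 + 20 ∧ s'.reg 1 = 3 * (n₁ + n₂) ∧
      s'.reg 2 = 4 * (n₁ + n₂) ∧ ∀ b < n₁ + n₂, ∀ r : ℕ, r < 4 →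
        EntryAt s'.mem (3 * (n₁ + n₂) + 12 * b + 3 * r) (corner (decide (n₁ ≤ b)) (e b) r) := by
  simp only [buildTable, wp_block_cons, wp_move (show 1 ≠ 30 by decide), wp_const, wp_add,
    wp_block_nil, State.reg_setReg, Nat.reduceEqDiff, if_true, if_false, h0, h1]
  refine wp.mono (wp_whilePos (fun k s' => s'.reg 1 = 3 * (n₁ + n₂) ∧
    s'.reg 2 = 4 * (n₁ + n₂) ∧ s'.reg 0 = n₁ - k ∧ s'.reg 3 = 3 * k ∧
    s'.reg 4 = 3 * (n₁ + n₂) + 12 * k ∧ s'.reg 5 = n₁ + n₂ - k ∧ EdgesAt s'.mem (n₁ + n₂) e ∧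
    ∀ b < k, ∀ r : ℕ, r < 4 → EntryAt s'.mem (3 * (n₁ + n₂) + 12 * b + 3 * r)
      (corner (decide (n₁ ≤ b)) (e b) r)) (n₁ + n₂) 159 ?_ ?_ ?_) ?_
  · rintro k s' hk ⟨g1, g2, g0, g3, g4, g5, gE, gT⟩
    refine ⟨by lia, ?_⟩
    obtain ⟨m0, m1, m2⟩ := gE k hk
    rw [← g3] at m0 m1 m2
    rw [wp_block_cons]
    refine (wp_readEdge m0 m1 m2).mono ?_
    rintro t₁ s₁ ⟨ht₁, hm₁, hr₁, h3₁, c0, c1, c2, c3⟩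
    rw [wp_block_cons]
    refine (wp_writeBlock s₁).mono ?_
    rintro t₂ s₂ ⟨ht₂, hr₂, h4₂, hm₂, d0, d1, d2, d3⟩
    have w₁ : s₁.reg 4 = 3 * (n₁ + n₂) + 12 * k := (hr₁ 4 (by lia) (by lia)).trans g4
    -- Register `0` counts down from `n₁` and goes on below zero, so its sign tells which list the
    -- current edge belongs to.
    have hd : decide (s'.reg 0 ≤ 0) = decide (n₁ ≤ k) := by
      rw [decide_eq_decide, g0]; lia
    have hr : ∀ r < 10, r ≠ 3 → r ≠ 4 → s₂.reg r = s'.reg r := fun r hr hr3 hr4 => by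
      rw [hr₂ r (by lia) hr4, hr₁ r hr hr3]
    have hm : ∀ c < 3 * ((n₁ : ℤ) + n₂) + 12 * k, s₂.mem c = s'.mem c := fun c hc => by
      rw [hm₂ c (by lia), hm₁]
    rw [hd] at c2 c3
    rw [w₁] at d0 d1 d2 d3
    rw [← c0] at d0
    rw [← c1] at d1
    rw [← c2] at d2
    rw [← c3] at d3
    simp only [wp_block_cons, wp_addConst (show 0 ≠ 30 by decide),
      wp_addConst (show 5 ≠ 30 by decide), wp_block_nil, State.reg_setReg, State.mem_setReg,
      Nat.reduceEqDiff, if_true, if_false]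
    refine ⟨by lia, ?_, ?_, ?_, ?_, ?_, ?_, fun j hj => ?_, fun b hb r hr4 => ?_⟩
    · simp [hr, g1]
    · simp [hr, g2]
    · simp [hr, g0]; ring
    · simp [hr₂, h3₁, g3]; ring
    · simp [h4₂, w₁]; ring
    · simp [hr, g5]; ring
    · rw [hm _ (by lia), hm _ (by lia), hm _ (by lia)]
      exact gE j hj
    · rcases Nat.lt_succ_iff_lt_or_eq.1 hb with hb | rfl
      · exact (gT b hb r hr4).congr (by lia) hm
      · have : r = 0 ∨ r = 1 ∨ r = 2 ∨ r = 3 := by lia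
        rcases this with rfl | rfl | rfl | rfl
        · simpa [corner] using d0
        · simpa [corner] using d1
        · simpa using d2
        · simpa using d3
  · rintro s' ⟨-, -, -, -, -, h5, -⟩
    rw [h5]; simp
  · refine ⟨?_, ?_, ?_, ?_, ?_, ?_, he, ?_⟩
    · simp; ring
    · simp; ring
    · simp [h0]
    · simp
    · simp; ring
    · simp
    · simp
  · rintro t s' ⟨ht, g1, g2, -, -, -, -, -, gT⟩
    exact ⟨by lia, g1, g2, gT⟩

theorem encode_cons (e : Edge) (l : List Edge) :
    encode (e :: l) = e.1.1 :: e.1.2 :: ((e.2 : ℕ) : ℤ) :: encode l := rfl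

theorem encode_getD (l : List Edge) {k : ℕ} (hk : k < l.length) :
    (encode l).getD (3 * k) 0 = (l.getD k default).1.1 ∧
    (encode l).getD (3 * k + 1) 0 = (l.getD k default).1.2 ∧
    (encode l).getD (3 * k + 2) 0 = ((l.getD k default).2 : ℕ) := by
  induction l generalizing k with
  | nil => simp at hk
  | cons e l ih =>
    cases k with
    | zero => simp [encode_cons]
    | succ k =>
      have := ih (k := k) (by simpa using hk)
      simpa [encode_cons, Nat.mul_succ] using this

theorem edgesAt_inputState (l₁ l₂ : List Edge) :
    EdgesAt (inputState l₁ l₂).mem (l₁.length + l₂.length) (blockEdge l₁ l₂) := by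
  intro k hk
  obtain ⟨h0, h1, h2⟩ := encode_getD (l₁ ++ l₂) (k := k) (by simpa using hk)
  have e0 : (3 * (k : ℤ)).toNat = 3 * k := by lia
  have e1 : (3 * (k : ℤ) + 1).toNat = 3 * k + 1 := by lia
  have e2 : (3 * (k : ℤ) + 2).toNat = 3 * k + 2 := by lia
  refine ⟨?_, ?_, ?_⟩
  · simp only [inputState, e0, h0, blockEdge]
    rw [if_pos (by lia)]
  · simp only [inputState, e1, h1, blockEdge]
    rw [if_pos (by lia)]
  · simp only [inputState, e2, h2, blockEdge]
    rw [if_pos (by lia)]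

/-- The decision procedure. -/
def decideTiling : Prog := .seq buildTable relaxRounds

theorem wp_decideTiling (l₁ l₂ : List Edge) :
    wp decideTiling (inputState l₁ l₂) fun t s =>
      t ≤ 6000 * (l₁.length + l₂.length + 1) ^ 3 ∧
      (Tilable l₁.toFinset l₂.toFinset → s.reg 0 = 1 ∧
        s.table = {a | a.1 ∈ (posNegGraph l₁.toFinset l₂.toFinset).verts ∧
          a.2 = (posNegGraph l₁.toFinset l₂.toFinset).bellmanFord a.1}) ∧
      (¬ Tilable l₁.toFinset l₂.toFinset → s.reg 0 = 0) := by
  set n := l₁.length + l₂.length with hn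
  have hF : Tilable l₁.toFinset l₂.toFinset ↔ (entryGraph (point l₁ l₂) n).Feasible := by
    rw [tilable_iff_feasible, feasible_iff_posNegGraph_feasible, hn, entryGraph_feasible_iff]
  rw [decideTiling, wp_seq]
  refine (wp_buildTable (n₁ := l₁.length) (n₂ := l₂.length) (by simp [inputState])
    (by simp [inputState]) (edgesAt_inputState l₁ l₂)).mono ?_
  rintro t₁ s₁ ⟨ht₁, h1, h2, hT⟩
  have hE : ∀ k < 4 * n, EntryAt s₁.mem (3 * n + 3 * k) (point l₁ l₂ k) := fun k hk => by
    have := hT (k / 4) (by lia) (k % 4) (by lia)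
    convert this using 1
    · lia
    · rfl
  refine (wp_relaxRounds (T := 3 * n) (n := n) (p := point l₁ l₂) (by lia) (by lia)
    (fun k hk => ⟨(hE k hk).1, (hE k hk).2.1⟩) (fun k hk => (hE k hk).2.2)).mono ?_
  rintro t₂ s₂ ⟨ht₂, g1, g2, gP, gF, gN⟩
  refine ⟨?_, fun hTil => ?_, fun hTil => gN (mt hF.2 hTil)⟩
  · have : n + 1 ≤ (n + 1) ^ 3 := Nat.le_self_pow (by lia) _
    lia
  · obtain ⟨g0, gM⟩ := gF (hF.1 hTil)
    have hpn := feasible_iff_posNegGraph_feasible.1 (tilable_iff_feasible.1 hTil)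
    have hentry : ∀ k < 4 * n, (((s₂.mem (s₂.reg 1 + 3 * k), s₂.mem (s₂.reg 1 + 3 * k + 1)),
        s₂.mem (s₂.reg 1 + 3 * k + 2)) : Vertex × ℤ) = (point l₁ l₂ k,
        (posNegGraph l₁.toFinset l₂.toFinset).bellmanFord (point l₁ l₂ k)) := fun k hk => by
      rw [bellmanFord_point hpn gM hk, g1, (gP k hk).1, (gP k hk).2]
      rfl
    refine ⟨g0, ?_⟩
    ext ⟨v, x⟩
    simp only [State.table, Set.mem_ofPred_eq]
    constructor
    · rintro ⟨k, hk, hx⟩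
      have hk' : k < 4 * n := by lia
      rw [hentry k hk', Prod.mk.injEq] at hx
      obtain ⟨rfl, rfl⟩ := hx
      exact ⟨point_mem hk', rfl⟩
    · rintro ⟨hv, rfl⟩
      obtain ⟨k, hk, rfl⟩ := exists_point hv
      exact ⟨k, by lia, (hentry k hk).symm⟩

/-- The lists may overlap, so their total length is only bounded by `2 * m`. For `m ≥ 1` one has `2
* m + 1 ≤ 3 * m`, whence the factor `27`; the summand `1` covers `m = 0`. -/
theorem cube_bound {a b m : ℕ} (ha : a ≤ m) (hb : b ≤ m) :
    6000 * (a + b + 1) ^ 3 ≤ 162000 * (m ^ 3 + 1) := by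
  have h1 : (a + b + 1) ^ 3 ≤ (2 * m + 1) ^ 3 := Nat.pow_le_pow_left (by lia) 3
  have h2 : (2 * m + 1) ^ 3 ≤ 27 * (m ^ 3 + 1) := by
    rcases Nat.eq_zero_or_pos m with rfl | hm
    · norm_num
    · calc (2 * m + 1) ^ 3 ≤ (3 * m) ^ 3 := Nat.pow_le_pow_left (by lia) 3
        _ = 27 * m ^ 3 := by ring
        _ ≤ _ := by lia
  lia

end LozengeGrid

open LozengeGrid
theorem mainTheorem6 :
    (∀ X₁ X₂ : Finset Edge,
      (Tilable X₁ X₂ ↔ (DC X₁ X₂).Feasible) ∧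
      (∀ x y z x' y' z' : ℤ, (posGraph X₁ X₂).IsDist (proj x y z) (proj x' y' z')
        ((x' - x) + (y' - y) + (z' - z) - 3 * min (x' - x) (min (y' - y) (z' - z)))) ∧
      (posNegGraph X₁ X₂).verts.Finite ∧
      (posNegGraph X₁ X₂).edges.Finite ∧
      ((DC X₁ X₂).Feasible ↔ (posNegGraph X₁ X₂).Feasible) ∧
      ((posNegGraph X₁ X₂).Feasible ↔ (posNegGraph X₁ X₂).BellmanFordAccepts)) ∧
    ∃ (P : Prog) (C : ℕ), ∀ (X₁ X₂ : Finset Edge) (l₁ l₂ : List Edge),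
      l₁.Nodup → l₂.Nodup → l₁.toFinset = X₁ → l₂.toFinset = X₂ →
      ∃ (t : ℕ) (s : State), Exec P (inputState l₁ l₂) t s ∧
        t ≤ C * ((X₁ ∪ X₂).card ^ 3 + 1) ∧
        (Tilable X₁ X₂ → s.reg 0 = 1 ∧
          s.table = {a | a.1 ∈ (posNegGraph X₁ X₂).verts ∧
            a.2 = (posNegGraph X₁ X₂).bellmanFord a.1}) ∧
        (¬ Tilable X₁ X₂ → s.reg 0 = 0) := by
  refine ⟨fun X₁ X₂ => ⟨tilable_iff_feasible, isDist_proj X₁ X₂, posNegGraph_verts_finite X₁ X₂,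
    posNegGraph_edges_finite X₁ X₂, feasible_iff_posNegGraph_feasible,
    WDigraph.feasible_iff_bellmanFordAccepts (posNegGraph_closed X₁ X₂)
      (posNegGraph_verts_finite X₁ X₂) (posNegGraph_edges_finite X₁ X₂)⟩,
    decideTiling, 162000, ?_⟩
  rintro _ _ l₁ l₂ hl₁ hl₂ rfl rfl
  obtain ⟨t, s, hE, ht, hT, hN⟩ := wp_decideTiling l₁ l₂
  refine ⟨t, s, hE, ht.trans (cube_bound ?_ ?_), hT, hN⟩
  -- Absence of repetitions bounds the length of a list by the number of constrained edges.
  · rw [← List.toFinset_card_of_nodup hl₁]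
    exact Finset.card_le_card Finset.subset_union_left
  · rw [← List.toFinset_card_of_nodup hl₂]
    exact Finset.card_le_card Finset.subset_union_right
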